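/- Let $p$ be a prime number, let $K$ be a number field in which $p$ is unramified and which contains no primitive $p$-th root of unity, and let $L=K(\omega)$ with $\omega^p\in K$ and $\omega^p$ not a $p$-th power in $K$. Assume that $L/K$ is (at most) tamely ramified. Let $\zeta$ be a primitive $p$-th root of unity, let $E=K(\zeta,\omega)$ be the Galois closure of $L/K$, $G=\mathrm{Gal}(E/K)$, $G'=\mathrm{Gal}(E/L)$, $X=G/G'$ (left cosets), and let $\lambda:G\to\mathrm{Perm}(X)$ be left translation. Let $\sigma\in G$ be given by $\sigma(\zeta)=\zeta$, $\sigma(\omega)=\zeta\omega$, let $\eta\in\mathrm{Perm}(X)$ be given by $\eta(\sigma^iG')=\sigma^{i-1}G'$, and let $N=\langle\eta\rangle$. Let $G$ act on $E[N]$ by Galois automorphisms on $E$ and by ${}^{g}n=\lambda(g)n\lambda(g)^{-1}$ on $N$. The $K$-algebra $H=E[N]^G$ acts on $L$ by $$\Big(\sum_{n\in N}c_n n\Big)\cdot x=\sum_{n\in N}c_n\,\big(n^{-1}[G']\big)(x)\qquad(x\in L),$$ where a coset $gG'$ acts on $x \in L$ by $gG'(x)=g(x)$. Let $\mathfrak A=\{h\in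 H: h\cdot O_L\subseteq O_L\}$ be the associated order of $O_L$ in $H$. For a nonzero prime ideal $\mathfrak p$ of $O_K$ let $K_{\mathfrak p}$ be the completion of $K$ at $\mathfrak p$, $O_{K,\mathfrak p}$ its ring of integers, $O_{L,\mathfrak p}=O_{K,\mathfrak p}\otimes_{O_K}O_L\subset L_{\mathfrak p}=K_{\mathfrak p}\otimes_K L$ and $\mathfrak A_{\mathfrak p}=O_{K,\mathfrak p}\otimes_{O_K}\mathfrak A$. Then $\mathfrak A=O_E[N]^G$, and $O_L$ is a locally free $\mathfrak A$-module of rank one, i.e. $O_{L,\mathfrak p}\cong\mathfrak A_{\mathfrak p}$ as $\mathfrak A_{\mathfrak p}$-modules for every nonzero prime $\mathfrak p$ of $O_K$. Moreover, there exists $\alpha\in O_L$ such that $L=K(\alpha)$, $a=\alpha^p\in O_K$ and $a\equiv1\pmod{p^2O_K}$; and for every such $\alpha$, every nonzero prime ideal $\mathfrak p$ of $O_K$ and every uniformizer $\pi_{\mathfrak p}$ of $K_{\mathfrak p}$, the element $$x_{\mathfrak p}=\begin{cases}\dfrac1p\displaystyle\sum_{j=0}^{p-1}\alpha^j&\text{if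 }\mathfrak p\mid pO_K,\\[2ex]\dfrac1p\displaystyle\sum_{j=0}^{p-1}\frac{\alpha^j}{\pi_{\mathfrak p}^{\lfloor v_{\mathfrak p}(a^j)/p\rfloor}}&\text{otherwise}\end{cases}$$ of $L_{\mathfrak p}$ lies in $O_{L,\mathfrak p}$ and is a free generator of $O_{L,\mathfrak p}$ as an $\mathfrak A_{\mathfrak p}$-module. -/

import Mathlib

open scoped NumberField TensorProduct

noncomputable section

namespace HopfGalois

/-- A finite extension `L/K` of number fields is *tame* if, for every nonzero prime `P` of `𝓞 L`,
the ramification index of `P` over `K` is not divisible by the residue characteristic of `P`. -/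
def IsTame (K L : Type*) [Field K] [Field L] [Algebra K L] : Prop :=
  ∀ P : Ideal (𝓞 L), P.IsPrime → P ≠ ⊥ → ∀ ℓ : ℕ, ℓ.Prime → (ℓ : 𝓞 L) ∈ P →
    ¬ ℓ ∣ P.ramificationIdx (𝓞 K)

section GreitherPareigis

variable (K L E : Type*) [Field K] [Field L] [Field E] [Algebra K L] [Algebra L E] [Algebra K E]
  [IsScalarTower K L E]

/-- `G' = Gal(E/L)`, as a subgroup of `G = Gal(E/K)`. -/
def galSubgroup : Subgroup (E ≃ₐ[K] E) :=
  (IsScalarTower.toAlgHom K L E).fieldRange.fixingSubgroup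

/-- The left coset space `X = G / G'`. -/
abbrev CosetSpace : Type _ := (E ≃ₐ[K] E) ⧸ galSubgroup K L E

/-- The left translation map `λ : G → Perm X`. -/
def leftTranslation : (E ≃ₐ[K] E) →* Equiv.Perm (CosetSpace K L E) :=
  MulAction.toPermHom (E ≃ₐ[K] E) (CosetSpace K L E)

variable {K L E}

lemma galSubgroup_apply {g : E ≃ₐ[K] E} (hg : g ∈ galSubgroup K L E) (x : L) :
    g (algebraMap L E x) = algebraMap L E x :=
  (IntermediateField.mem_fixingSubgroup_iff _ _).1 hg _ ⟨x, rfl⟩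

/-- Evaluation of cosets at an element `x` of `L`: the coset `g G'` is sent to `g(x)`. -/
def cosetEval (x : L) (y : CosetSpace K L E) : E :=
  Quotient.liftOn' y (fun g => g (algebraMap L E x)) fun a b hab => by
    have h := galSubgroup_apply (QuotientGroup.leftRel_apply.1 hab) x
    have h2 := congrArg a h
    rw [← AlgEquiv.mul_apply, mul_inv_cancel_left] at h2
    exact h2.symm

@[simp] lemma cosetEval_mk (x : L) (g : E ≃ₐ[K] E) :
    cosetEval x (QuotientGroup.mk g : CosetSpace K L E) = g (algebraMap L E x) := rfl

variable (K L E)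

/-- The action of `g ∈ G` on `E[Perm X]`: by Galois automorphisms on `E` and by conjugation via `λ`
on `Perm X`. -/
def galAct (g : E ≃ₐ[K] E) :
    MonoidAlgebra E (Equiv.Perm (CosetSpace K L E)) →ₐ[K]
      MonoidAlgebra E (Equiv.Perm (CosetSpace K L E)) :=
  (MonoidAlgebra.mapDomainAlgHom K E
      (MulAut.conj (leftTranslation K L E g)).toMonoidHom).comp
    (MonoidAlgebra.mapAlgHom (Equiv.Perm (CosetSpace K L E)) (g : E →ₐ[K] E))

/-- The fixed subalgebra `E[Perm X]^G`. -/
def permInvariants : Subalgebra K (MonoidAlgebra E (Equiv.Perm (CosetSpace K L E))) :=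
  ⨅ g : E ≃ₐ[K] E, AlgHom.equalizer (galAct K L E g) (AlgHom.id K _)

variable {K L E}

/-- The inclusion `E[N] → E[Perm X]`. -/
def inclPerm (N : Subgroup (Equiv.Perm (CosetSpace K L E))) :
    MonoidAlgebra E N →ₐ[K] MonoidAlgebra E (Equiv.Perm (CosetSpace K L E)) :=
  MonoidAlgebra.mapDomainAlgHom K E N.subtype

/-- `H = E[N]^G`, for a subgroup `N` of `Perm X` (normalized by `λ(G)`), where `G` acts on `E` by
Galois automorphisms and on `N` by conjugation via `λ`. -/
def hopfAlg (N : Subgroup (Equiv.Perm (CosetSpace K L E))) :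
    Subalgebra K (MonoidAlgebra E N) :=
  (permInvariants K L E).comap (inclPerm N)

variable (K L E) in
/-- `E[Perm X]` acts on the functions `X → E` by `(c n · f)(y) = c f(n⁻¹ y)`. -/
def permRep : MonoidAlgebra E (Equiv.Perm (CosetSpace K L E)) →ₐ[E]
    Module.End E (CosetSpace K L E → E) :=
  MonoidAlgebra.lift E (Module.End E (CosetSpace K L E → E)) (Equiv.Perm (CosetSpace K L E))
    { toFun := fun n => LinearMap.funLeft E E (n⁻¹ : Equiv.Perm (CosetSpace K L E))
      map_one' := by ext; simp [LinearMap.funLeft]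
      map_mul' := by intro m n; ext; simp [LinearMap.funLeft] }

lemma permRep_single (n : Equiv.Perm (CosetSpace K L E)) (c : E) (f : CosetSpace K L E → E)
    (y : CosetSpace K L E) :
    permRep K L E (MonoidAlgebra.single n c) f y = c * f (n⁻¹ y) := by
  simp [permRep, LinearMap.funLeft]

lemma permRep_galAct (g : E ≃ₐ[K] E) (h : MonoidAlgebra E (Equiv.Perm (CosetSpace K L E)))
    (f : CosetSpace K L E → E)
    (hf : ∀ (s : E ≃ₐ[K] E) (y : CosetSpace K L E), f (s • y) = s (f y))
    (y : CosetSpace K L E) :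
    permRep K L E (galAct K L E g h) f (g • y) = g (permRep K L E h f y) := by
  induction h using MonoidAlgebra.induction_linear with
  | zero => simp
  | add a b ha hb => simp [ha, hb]
  | single n c =>
    have : galAct K L E g (MonoidAlgebra.single n c) =
        MonoidAlgebra.single (leftTranslation K L E g * n * (leftTranslation K L E g)⁻¹) (g c) := by
      simp [galAct]
    rw [this, permRep_single, permRep_single, map_mul, ← hf]
    congr 2
    have h1 : g • y = leftTranslation K L E g y := rfl
    have h2 : g • (n⁻¹ y) = leftTranslation K L E g (n⁻¹ y) := rfl
    rw [h1, h2]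
    simp [mul_inv_rev]

lemma cosetEval_smul (x : L) (s : E ≃ₐ[K] E) (y : CosetSpace K L E) :
    cosetEval x (s • y) = s (cosetEval x y) := by
  induction y using QuotientGroup.induction_on with
  | H z => rfl

lemma cosetEval_injective {x x' : L}
    (h : (cosetEval x : CosetSpace K L E → E) = cosetEval x') : x = x' := by
  have := congrFun h (QuotientGroup.mk 1)
  exact (algebraMap L E).injective this

lemma exists_cosetEval [FiniteDimensional K E] [IsGalois K E] (f : CosetSpace K L E → E)
    (hf : ∀ (s : E ≃ₐ[K] E) (y : CosetSpace K L E), f (s • y) = s (f y)) :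
    ∃ x : L, cosetEval x = f := by
  have hmem : f (QuotientGroup.mk 1) ∈ (IsScalarTower.toAlgHom K L E).fieldRange := by
    rw [← IsGalois.fixedField_fixingSubgroup (IsScalarTower.toAlgHom K L E).fieldRange,
      IntermediateField.mem_fixedField_iff]
    intro g hg
    rw [← hf]
    congr 1
    change (QuotientGroup.mk (g * 1) : CosetSpace K L E) = QuotientGroup.mk 1
    rw [QuotientGroup.eq]
    simpa [galSubgroup] using hg
  obtain ⟨x, hx⟩ := hmem
  refine ⟨x, funext fun y => ?_⟩
  induction y using QuotientGroup.induction_on with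
  | H z =>
    have h1 : (QuotientGroup.mk z : CosetSpace K L E) = z • QuotientGroup.mk 1 := by
      change _ = QuotientGroup.mk (z * 1)
      rw [mul_one]
    rw [h1, hf, ← hx, cosetEval_smul]
    rfl

lemma exists_act [FiniteDimensional K E] [IsGalois K E]
    {N : Subgroup (Equiv.Perm (CosetSpace K L E))} (h : hopfAlg N) (x : L) :
    ∃ z : L, (cosetEval z : CosetSpace K L E → E) =
      permRep K L E (inclPerm N h) (cosetEval x) := by
  refine exists_cosetEval _ fun s y => ?_
  have hs : galAct K L E s (inclPerm N h) = inclPerm N h := by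
    have := h.2
    simp only [hopfAlg, permInvariants, Subalgebra.mem_comap, Algebra.mem_iInf] at this
    exact this s
  conv_lhs => rw [← hs]
  exact permRep_galAct _ _ _ (cosetEval_smul x) y

/-- The action of `h ∈ H = E[N]^G` on `x ∈ L`; see `algebraMap_act` for the explicit formula
`(∑ cₙ n) · x = ∑ cₙ (n⁻¹[1_G G'])(x)`. -/
def act [FiniteDimensional K E] [IsGalois K E]
    {N : Subgroup (Equiv.Perm (CosetSpace K L E))} (h : hopfAlg N) (x : L) : L :=
  (exists_act h x).choose

lemma cosetEval_add (x y : L) :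
    (cosetEval (x + y) : CosetSpace K L E → E) = cosetEval x + cosetEval y := by
  funext z
  induction z using QuotientGroup.induction_on with
  | H z => simp

lemma cosetEval_zero : (cosetEval (0 : L) : CosetSpace K L E → E) = 0 := by
  funext z
  induction z using QuotientGroup.induction_on with
  | H z => simp

lemma cosetEval_smul_base (k : K) (x : L) :
    (cosetEval (k • x) : CosetSpace K L E → E) = algebraMap K E k • cosetEval x := by
  funext z
  induction z using QuotientGroup.induction_on with
  | H z => simp [Algebra.smul_def, ← IsScalarTower.algebraMap_apply]

section

variable [FiniteDimensional K E] [IsGalois K E] {N : Subgroup (Equiv.Perm (CosetSpace K L E))}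

lemma cosetEval_act (h : hopfAlg N) (x : L) :
    (cosetEval (act h x) : CosetSpace K L E → E) = permRep K L E (inclPerm N h) (cosetEval x) :=
  (exists_act h x).choose_spec

lemma algebraMap_act (h : hopfAlg N) (x : L) :
    algebraMap L E (act h x) = (h : MonoidAlgebra E N).coeff.sum fun n c =>
      c * cosetEval x ((n : Equiv.Perm (CosetSpace K L E))⁻¹ (QuotientGroup.mk 1)) := by
  have h1 : ∀ a : MonoidAlgebra E N,
      permRep K L E (inclPerm N a) (cosetEval x) (QuotientGroup.mk 1) = a.coeff.sum fun n c =>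
        c * cosetEval x ((n : Equiv.Perm (CosetSpace K L E))⁻¹ (QuotientGroup.mk 1)) := by
    intro a
    induction a using MonoidAlgebra.induction_linear with
    | zero => simp
    | add a b ha hb =>
      rw [map_add, map_add, LinearMap.add_apply, Pi.add_apply, ha, hb, MonoidAlgebra.coeff_add,
        Finsupp.sum_add_index'] <;> simp [add_mul]
    | single n c =>
      have : inclPerm N (MonoidAlgebra.single n c) =
          MonoidAlgebra.single (n : Equiv.Perm (CosetSpace K L E)) c := by
        simp [inclPerm]
      rw [this, permRep_single]
      simp
  exact (congrFun (cosetEval_act h x) (QuotientGroup.mk 1)).trans (h1 _)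

instance : SMul (hopfAlg N) L := ⟨act⟩

lemma smul_eq_act (h : hopfAlg N) (x : L) : h • x = act h x := rfl

/-- `L` as an `H`-module, where `H = E[N]^G`. -/
instance : Module (hopfAlg N) L where
  one_smul x := cosetEval_injective (by simp only [smul_eq_act]; rw [cosetEval_act (1 : hopfAlg N) x]; simp)
  mul_smul a b x := cosetEval_injective (by
    simp only [smul_eq_act]; rw [cosetEval_act (a * b) x, cosetEval_act a, cosetEval_act b]; simp)
  smul_zero a := cosetEval_injective (by simp only [smul_eq_act]; rw [cosetEval_act a, cosetEval_zero]; simp)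
  smul_add a x y := cosetEval_injective (by
    simp only [smul_eq_act]; rw [cosetEval_act a, cosetEval_add, cosetEval_add, cosetEval_act a, cosetEval_act a, map_add])
  add_smul a b x := cosetEval_injective (by
    simp only [smul_eq_act]; rw [cosetEval_act (a + b) x, cosetEval_add, cosetEval_act a, cosetEval_act b]; simp)
  zero_smul x := cosetEval_injective (by
    simp only [smul_eq_act]; rw [cosetEval_act (0 : hopfAlg N) x, cosetEval_zero]; simp)

instance : IsScalarTower K (hopfAlg N) L where
  smul_assoc k h x := cosetEval_injective (by
    rw [smul_eq_act, smul_eq_act, cosetEval_act, cosetEval_smul_base, cosetEval_act]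
    have : inclPerm N ((k • h : hopfAlg N) : MonoidAlgebra E N) =
        algebraMap K E k • inclPerm N (h : MonoidAlgebra E N) := by
      rw [algebraMap_smul]; simp
    rw [this, map_smul, LinearMap.smul_apply])

instance : SMulCommClass K (hopfAlg N) L :=
  IsScalarTower.to_smulCommClass

end

end GreitherPareigis

section Orders

lemma coe_smul_integers {K L : Type*} [Field K] [Field L] [Algebra K L] (r : 𝓞 K) (x : 𝓞 L) :
    ((r • x : 𝓞 L) : L) = r • (x : L) :=
  map_smul (IsScalarTower.toAlgHom (𝓞 K) (𝓞 L) L) r x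

variable {K L E : Type*} [Field K] [Field L] [Field E] [NumberField K] [NumberField E]
  [Algebra K L] [Algebra L E] [Algebra K E] [IsScalarTower K L E]
  (N : Subgroup (Equiv.Perm (CosetSpace K L E)))

/-- `O_E[N]^G`, as an `O_K`-subalgebra of `H = E[N]^G`. -/
def integralInvariants : Subalgebra (𝓞 K) (hopfAlg N) :=
  (MonoidAlgebra.mapAlgHom N (IsScalarTower.toAlgHom (𝓞 K) (𝓞 E) E)).range.comap
    ((hopfAlg N).val.restrictScalars (𝓞 K))

variable [IsGalois K E]

/-- The associated order `𝔄 = {h ∈ H | h · O_L ⊆ O_L}` of `O_L` in `H = E[N]^G`. -/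
def associatedOrder : Subalgebra (𝓞 K) (hopfAlg N) where
  carrier := {h | ∀ x : 𝓞 L, h • (x : L) ∈ integralClosure ℤ L}
  mul_mem' {a b} ha hb x := by
    rw [mul_smul]
    exact ha ⟨b • (x : L), hb x⟩
  add_mem' {a b} ha hb x := by
    rw [add_smul]
    exact add_mem (ha x) (hb x)
  algebraMap_mem' r x := by
    rw [IsScalarTower.algebraMap_apply (𝓞 K) K (hopfAlg N), algebraMap_smul]
    have : algebraMap (𝓞 K) K r • (x : L) = ((r • x : 𝓞 L) : L) := by
      rw [algebraMap_smul, coe_smul_integers]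
    rw [this]
    exact (r • x : 𝓞 L).2

variable {N}

/-- `O_L` as a module over its associated order. -/
instance : Module (associatedOrder N) (𝓞 L) where
  smul h x := ⟨(h : hopfAlg N) • (x : L), h.2 x⟩
  one_smul x := Subtype.ext (one_smul (hopfAlg N) (x : L))
  mul_smul a b x := Subtype.ext (mul_smul (a : hopfAlg N) (b : hopfAlg N) (x : L))
  smul_zero a := Subtype.ext (smul_zero (a : hopfAlg N))
  smul_add a x y := Subtype.ext (smul_add (a : hopfAlg N) (x : L) (y : L))
  add_smul a b x := Subtype.ext (add_smul (a : hopfAlg N) (b : hopfAlg N) (x : L))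
  zero_smul x := Subtype.ext (zero_smul (hopfAlg N) (x : L))

lemma coe_associatedOrder_smul (h : associatedOrder N) (x : 𝓞 L) :
    ((h • x : 𝓞 L) : L) = (h : hopfAlg N) • (x : L) := rfl

instance : IsScalarTower (𝓞 K) (associatedOrder N) (𝓞 L) where
  smul_assoc r h x := Subtype.ext (by
    change (((r • h) • x : 𝓞 L) : L) = ((r • (h • x) : 𝓞 L) : L)
    rw [coe_smul_integers, Algebra.smul_def, mul_smul, coe_associatedOrder_smul]
    change (algebraMap (𝓞 K) (hopfAlg N) r) • ((h • x : 𝓞 L) : L) = _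
    rw [IsScalarTower.algebraMap_apply (𝓞 K) K (hopfAlg N), algebraMap_smul, algebraMap_smul])

instance : SMulCommClass (associatedOrder N) (𝓞 K) (𝓞 L) :=
  have : SMulCommClass (𝓞 K) (associatedOrder N) (𝓞 L) := IsScalarTower.to_smulCommClass
  SMulCommClass.symm _ _ _

end Orders

section Local

open IsDedekindDomain

variable {K L E : Type*} [Field K] [Field L] [Field E] [NumberField K] [NumberField L]
  [NumberField E] [Algebra K L] [Algebra L E] [Algebra K E] [IsScalarTower K L E] [IsGalois K E]

/-- `O_{L,𝔭} = O_{K,𝔭} ⊗_{O_K} O_L`, where `O_{K,𝔭}` is the completed ring of integers. -/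
abbrev LocalIntegers (L : Type*) [Field L] [NumberField L] [Algebra K L]
    (v : HeightOneSpectrum (𝓞 K)) : Type _ :=
  v.adicCompletionIntegers K ⊗[𝓞 K] 𝓞 L

/-- `𝔄_𝔭 = O_{K,𝔭} ⊗_{O_K} 𝔄`. -/
abbrev LocalOrder (N : Subgroup (Equiv.Perm (CosetSpace K L E)))
    (v : HeightOneSpectrum (𝓞 K)) : Type _ :=
  v.adicCompletionIntegers K ⊗[𝓞 K] associatedOrder N

/-- The action of `𝔄_𝔭` on `O_{L,𝔭}`: `(c ⊗ h) · (d ⊗ x) = cd ⊗ (h · x)`. -/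
def localAct (N : Subgroup (Equiv.Perm (CosetSpace K L E))) (v : HeightOneSpectrum (𝓞 K)) :
    LocalOrder N v →ₐ[v.adicCompletionIntegers K]
      Module.End (v.adicCompletionIntegers K) (LocalIntegers L v) :=
  (LinearMap.tensorProductEnd (𝓞 K) (v.adicCompletionIntegers K) (𝓞 L)).comp
    (Algebra.TensorProduct.map (AlgHom.id (v.adicCompletionIntegers K) _)
      (Algebra.lsmul (𝓞 K) (𝓞 K) (𝓞 L) : associatedOrder N →ₐ[𝓞 K] Module.End (𝓞 K) (𝓞 L)))

instance (N : Subgroup (Equiv.Perm (CosetSpace K L E))) (v : HeightOneSpectrum (𝓞 K)) :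
    Module (LocalOrder N v) (LocalIntegers L v) :=
  Module.compHom (LocalIntegers L v) (localAct N v).toRingHom

lemma tmul_smul_tmul (N : Subgroup (Equiv.Perm (CosetSpace K L E))) (v : HeightOneSpectrum (𝓞 K))
    (c d : v.adicCompletionIntegers K) (h : associatedOrder N) (x : 𝓞 L) :
    (c ⊗ₜ[𝓞 K] h : LocalOrder N v) • (d ⊗ₜ[𝓞 K] x : LocalIntegers L v) =
      (c * d) ⊗ₜ[𝓞 K] (h • x) := by
  change localAct N v (c ⊗ₜ[𝓞 K] h) (d ⊗ₜ[𝓞 K] x) = _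
  change (c • LinearMap.baseChange (v.adicCompletionIntegers K)
    (Algebra.lsmul (𝓞 K) (𝓞 K) (𝓞 L) h)) (d ⊗ₜ[𝓞 K] x) = _
  rw [LinearMap.smul_apply, LinearMap.baseChange_tmul, TensorProduct.smul_tmul']
  rfl

instance (v : HeightOneSpectrum (𝓞 K)) :
    IsScalarTower (𝓞 K) (v.adicCompletionIntegers K) (v.adicCompletion K) :=
  HeightOneSpectrum.adicCompletion.instIsScalarTower' (𝓞 K) K v

/-- The natural (injective) map from `O_{L,𝔭} = O_{K,𝔭} ⊗_{O_K} O_L` to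
`L_𝔭 = K_𝔭 ⊗_K L`. -/
def toLocalField (L : Type*) [Field L] [NumberField L] [Algebra K L]
    (v : HeightOneSpectrum (𝓞 K)) :
    LocalIntegers L v →ₐ[𝓞 K] v.adicCompletion K ⊗[K] L :=
  Algebra.TensorProduct.productMap
    (((Algebra.TensorProduct.includeLeft :
        v.adicCompletion K →ₐ[K] v.adicCompletion K ⊗[K] L).restrictScalars (𝓞 K)).comp
      (IsScalarTower.toAlgHom (𝓞 K) (v.adicCompletionIntegers K) (v.adicCompletion K)))
    (((Algebra.TensorProduct.includeRight :
        L →ₐ[K] v.adicCompletion K ⊗[K] L).restrictScalars (𝓞 K)).comp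
      (IsScalarTower.toAlgHom (𝓞 K) (𝓞 L) L))

/-- `y` is a free generator of the `A`-module `M`, i.e. `A → M, a ↦ a y` is bijective. -/
def IsFreeGenerator (A : Type*) {M : Type*} [Ring A] [AddCommGroup M] [Module A M] (y : M) :
    Prop :=
  Function.Bijective fun a : A => a • y

/-- The normalized additive valuation `v_𝔭(x)` of a nonzero element `x` of `K`. -/
def ord (v : HeightOneSpectrum (𝓞 K)) (x : K) : ℤ := -WithZero.log (v.valuation K x)

/-- `r_𝔭(x) = ⌊v_𝔭(x) / p⌋`. -/
def rFloor (p : ℕ) (v : HeightOneSpectrum (𝓞 K)) (x : K) : ℤ := ⌊(ord v x : ℚ) / (p : ℚ)⌋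

/-- The element `x_𝔭` of `L_𝔭 = K_𝔭 ⊗_K L`: it is `(1/p) ∑ α^j` if `𝔭 ∣ p`, and
`(1/p) ∑ α^j / π^{r_𝔭(a^j)}` otherwise, where `j` runs through `0, …, p - 1`. -/
def localGenerator (p : ℕ) (α : L) (a : K) (v : HeightOneSpectrum (𝓞 K))
    (π : v.adicCompletion K) : v.adicCompletion K ⊗[K] L :=
  open Classical in
  if (p : 𝓞 K) ∈ v.asIdeal then
    1 ⊗ₜ[K] ((p : L)⁻¹ * ∑ j ∈ Finset.range p, α ^ j)
  else
    (p : K)⁻¹ • ∑ j ∈ Finset.range p, (π ^ rFloor p v (a ^ j))⁻¹ ⊗ₜ[K] (α ^ j)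

end Local

end HopfGalois

end

noncomputable section

namespace HopfGalois

open IsDedekindDomain

section Valuations

/-- If `x ^ p` is congruent to `1` modulo `p ^ 2`, then `x` is congruent to a `p`-th root of unity
modulo `p`. -/
theorem exists_root_of_unity_valuation_sub_le {F Γ₀ : Type*} [Field F]
    [LinearOrderedCommGroupWithZero Γ₀] (v : Valuation F Γ₀) {p : ℕ} (hp : 0 < p) {ζ : F}
    (hζ : IsPrimitiveRoot ζ p) (hvp : v p ≠ 0) {x : F} (hx : v (x ^ p - 1) ≤ v p ^ 2) :
    ∃ r : F, r ^ p = 1 ∧ v (x - r) ≤ v p := by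
  classical
  have hprod := Polynomial.X_pow_sub_one_eq_prod hp hζ
  obtain ⟨r, hr, hmin⟩ := Finset.exists_min_image (Polynomial.nthRootsFinset p (1 : F))
    (fun r => v (x - r)) ⟨1, by simp [Polynomial.mem_nthRootsFinset hp]⟩
  have hr1 : r ^ p = 1 := (Polynomial.mem_nthRootsFinset hp _).1 hr
  refine ⟨r, hr1, ?_⟩
  rw [← Finset.mul_prod_erase _ _ hr] at hprod
  have hx' : v (x - r) * ∏ s ∈ (Polynomial.nthRootsFinset p (1 : F)).erase r, v (x - s) =
      v (x ^ p - 1) := by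
    have := congrArg (Polynomial.eval x) hprod
    simp only [Polynomial.eval_sub, Polynomial.eval_pow, Polynomial.eval_X, Polynomial.eval_one,
      Polynomial.eval_mul, Polynomial.eval_C, Polynomial.eval_prod] at this
    rw [this, map_mul, map_prod]
  have hder : ∏ s ∈ (Polynomial.nthRootsFinset p (1 : F)).erase r, v (r - s) = v p := by
    have := congrArg (fun f => Polynomial.eval r (Polynomial.derivative f)) hprod
    simp only [Polynomial.derivative_sub, Polynomial.derivative_X_pow, Polynomial.derivative_one,
      Polynomial.derivative_mul, Polynomial.derivative_X, Polynomial.derivative_C,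
      Polynomial.eval_add, Polynomial.eval_sub, Polynomial.eval_pow, Polynomial.eval_X,
      Polynomial.eval_mul, Polynomial.eval_C, Polynomial.eval_prod, sub_self, zero_mul, add_zero,
      sub_zero, one_mul] at this
    rw [← map_prod, ← this, map_mul, map_pow]
    have hvr : v r = 1 := by
      have h := congrArg v hr1
      rw [map_pow, map_one] at h
      exact (pow_eq_one_iff_of_nonneg zero_le hp.ne').1 h
    simp [hvr]
  have hle : v p ≤ ∏ s ∈ (Polynomial.nthRootsFinset p (1 : F)).erase r, v (x - s) := by
    rw [← hder]
    refine Finset.prod_le_prod' fun s hs => ?_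
    have h1 : r - s = (x - s) - (x - r) := by ring
    rw [h1]
    exact (v.map_sub _ _).trans (max_le le_rfl (hmin s (Finset.mem_of_mem_erase hs)))
  have h2 : v (x - r) * v p ≤ v p * v p := by
    calc _ ≤ _ := mul_le_mul_right hle _
      _ = _ := hx'
      _ ≤ _ := hx.trans (by rw [sq])
  exact le_of_mul_le_mul_right h2 (zero_lt_iff.2 hvp)

open WithZero in
theorem le_exp_neg_one_of_lt_one {x : ℤᵐ⁰} (h : x < 1) : x ≤ exp (-1 : ℤ) := by
  rcases eq_or_ne x 0 with rfl | hx
  · exact zero_le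
  · rw [← log_le_iff_le_exp hx]
    have := (log_lt_iff_lt_exp (a := 0) hx).2 (by simpa using h)
    omega

open WithZero in
theorem log_eq_of_pow_eq_pow {x y : ℤᵐ⁰} {m n : ℕ} (h : x ^ m = y ^ n) :
    (m : ℤ) * log x = n * log y := by
  simpa [log_pow] using congrArg log h

end Valuations

section NumberFields

variable {K L : Type*} [Field K] [NumberField K] [Field L] [NumberField L] [Algebra K L]

theorem exists_valuation_extension_of_isTame (htame : IsTame K L) {p : ℕ} (hp : p.Prime)
    (v : HeightOneSpectrum (𝓞 K)) (hv : (p : 𝓞 K) ∈ v.asIdeal) :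
    ∃ (w : HeightOneSpectrum (𝓞 L)) (e : ℕ), ¬ p ∣ e ∧
      ∀ x : K, w.valuation L (algebraMap K L x) = v.valuation K x ^ e := by
  have hmax : v.asIdeal.IsMaximal := v.isMaximal
  obtain ⟨Q, hQ, hQv⟩ := Ideal.exists_maximal_ideal_liesOver_of_isIntegral (S := 𝓞 L) v.asIdeal
  have hQ0 : Q ≠ ⊥ := Ideal.ne_bot_of_liesOver_of_ne_bot v.ne_bot Q
  let w : HeightOneSpectrum (𝓞 L) := ⟨Q, hQ.isPrime, hQ0⟩
  have : w.asIdeal.LiesOver v.asIdeal := hQv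
  have hQp := hQ.isPrime
  refine ⟨w, Q.ramificationIdx (𝓞 K), htame Q hQ.isPrime hQ0 p hp ?_, fun x => ?_⟩
  · have := (Ideal.mem_of_liesOver Q v.asIdeal (p : 𝓞 K)).1 hv
    simpa using this
  · rw [← HeightOneSpectrum.valuation_liesOver L v w x,
      Ideal.ramificationIdx'_eq_ramificationIdx v.asIdeal Q v.ne_bot]

theorem valuation_natCast_of_isUnramifiedIn {p : ℕ} (hp : p.Prime)
    (hunr : Algebra.IsUnramifiedIn (𝓞 K) (Ideal.span {(p : ℤ)}))
    (v : HeightOneSpectrum (𝓞 K)) (hv : (p : 𝓞 K) ∈ v.asIdeal) :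
    v.valuation K (p : K) = WithZero.exp (-1 : ℤ) := by
  have hpZ : Prime (p : ℤ) := Nat.prime_iff_prime_int.1 hp
  let u : HeightOneSpectrum ℤ := ⟨Ideal.span {(p : ℤ)},
    (Ideal.span_singleton_prime hpZ.ne_zero).2 hpZ, by simpa using hpZ.ne_zero⟩
  have hover : v.asIdeal.LiesOver (Ideal.span {(p : ℤ)}) := by
    constructor
    have hmax : (Ideal.span {(p : ℤ)}).IsMaximal := u.isMaximal
    refine hmax.eq_of_le (v.isPrime.under ℤ).ne_top ?_
    rw [Ideal.span_singleton_le_iff_mem, Ideal.mem_comap]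
    simpa using hv
  have : v.asIdeal.LiesOver u.asIdeal := hover
  have hvp := v.isPrime
  have h1 : v.asIdeal.ramificationIdx ℤ = 1 := hunr.ramificationIdx_eq_one hover
  have h2 := HeightOneSpectrum.intValuation_liesOver u v (p : ℤ)
  rw [Ideal.ramificationIdx'_eq_ramificationIdx u.asIdeal v.asIdeal u.ne_bot, h1, pow_one,
    u.intValuation_singleton hpZ.ne_zero rfl] at h2
  have h3 : (p : K) = algebraMap (𝓞 K) K (p : 𝓞 K) := by simp
  rw [h3, HeightOneSpectrum.valuation_of_algebraMap]
  simpa using h2.symm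

theorem natCast_pow_dvd_of_valuation_le {p : ℕ} (hp : p.Prime)
    (hunr : Algebra.IsUnramifiedIn (𝓞 K) (Ideal.span {(p : ℤ)})) {x : 𝓞 K} {k : ℕ}
    (hx : ∀ v : HeightOneSpectrum (𝓞 K), (p : 𝓞 K) ∈ v.asIdeal →
      v.valuation K (algebraMap (𝓞 K) K x) ≤ WithZero.exp (-(k : ℤ))) :
    (p : 𝓞 K) ^ k ∣ x := by
  have hp0 : (p : K) ≠ 0 := by exact_mod_cast hp.ne_zero
  have : algebraMap (𝓞 K) K x / (p : K) ^ k ∈ (algebraMap (𝓞 K) K).range := by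
    refine HeightOneSpectrum.mem_integers_of_valuation_le_one K _ fun v => ?_
    rw [map_div₀, map_pow]
    by_cases hv : (p : 𝓞 K) ∈ v.asIdeal
    · rw [valuation_natCast_of_isUnramifiedIn hp hunr v hv, ← WithZero.exp_nsmul]
      refine div_le_one_of_le₀ ?_ zero_le
      simpa using hx v hv
    · have h1 : v.valuation K (p : K) = 1 := by
        have := (v.valuation_eq_one_iff_notMem (K := K) (r := (p : 𝓞 K))).2 hv
        simpa using this
      rw [h1, one_pow, div_one]
      exact v.valuation_le_one x
  obtain ⟨y, hy⟩ := this
  refine ⟨y, FaithfulSMul.algebraMap_injective (𝓞 K) K ?_⟩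
  rw [map_mul, map_pow, map_natCast, hy]
  field_simp

/-- An element of `K` that is integral at all primes dividing `p` has a denominator that is prime
to `p`. -/
theorem exists_denominator_prime_to {p : ℕ} (hp : p ≠ 0) {z : K}
    (hz : ∀ v : HeightOneSpectrum (𝓞 K), (p : 𝓞 K) ∈ v.asIdeal → v.valuation K z ≤ 1) :
    ∃ d b : 𝓞 K, algebraMap (𝓞 K) K d * z = algebraMap (𝓞 K) K b ∧
      ∀ v : HeightOneSpectrum (𝓞 K), (p : 𝓞 K) ∈ v.asIdeal → d ∉ v.asIdeal := by
  let D : Ideal (𝓞 K) := Submodule.comap (LinearMap.toSpanSingleton (𝓞 K) K z)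
    (LinearMap.range (Algebra.linearMap (𝓞 K) K))
  have htop : D ⊔ Ideal.span {(p : 𝓞 K)} = ⊤ := by
    by_contra hne
    obtain ⟨M, hM, hle⟩ := Ideal.exists_le_maximal _ hne
    have hpM : (p : 𝓞 K) ∈ M := hle (Ideal.mem_sup_right (Ideal.mem_span_singleton_self _))
    have hM0 : M ≠ ⊥ := by
      rintro rfl
      exact hp (by exact_mod_cast (Ideal.mem_bot.1 hpM))
    let v : HeightOneSpectrum (𝓞 K) := ⟨M, hM.isPrime, hM0⟩
    obtain ⟨n, d, hd⟩ := v.exists_primeCompl_mul_eq_of_integer z (hz v hpM)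
    refine d.2 (hle (Ideal.mem_sup_left ?_))
    exact ⟨n, by simp [← hd, Algebra.smul_def, mul_comm]⟩
  obtain ⟨d, hd, q, hq, hdq⟩ := Submodule.mem_sup.1 ((Ideal.eq_top_iff_one _).1 htop)
  obtain ⟨b, hb⟩ := hd
  refine ⟨d, b, ?_, fun v hv hdv => v.isPrime.ne_top ?_⟩
  · simpa [Algebra.smul_def] using hb.symm
  · rw [Ideal.eq_top_iff_one, ← hdq]
    exact add_mem hdv ((Ideal.span_singleton_le_iff_mem _).2 hv hq)

theorem exists_valuation_eq_of_finite (S : Set (HeightOneSpectrum (𝓞 K))) (hS : S.Finite)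
    (m : HeightOneSpectrum (𝓞 K) → ℕ) :
    ∃ c : 𝓞 K, c ≠ 0 ∧ ∀ v ∈ S,
      v.valuation K (algebraMap (𝓞 K) K c) = WithZero.exp (-(m v : ℤ)) := by
  classical
  choose u hu using fun v : HeightOneSpectrum (𝓞 K) => v.intValuation_exists_uniformizer
  by_cases hemp : S = ∅
  · exact ⟨1, one_ne_zero, by simp [hemp]⟩
  obtain ⟨c, hc⟩ := IsDedekindDomain.exists_forall_sub_mem_ideal (s := hS.toFinset)
    (fun v : HeightOneSpectrum (𝓞 K) => v.asIdeal) (fun v => m v + 1) (fun v _ => v.prime)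
    (fun v _ w _ hvw h => hvw (HeightOneSpectrum.ext h)) (fun v => u v ^ m v)
  have key : ∀ v ∈ S, v.valuation K (algebraMap (𝓞 K) K c) = WithZero.exp (-(m v : ℤ)) := by
    intro v hv
    have h1 := hc v (hS.mem_toFinset.2 hv)
    rw [← v.intValuation_le_pow_iff_mem] at h1
    have h2 : v.intValuation (u v ^ m v) = WithZero.exp (-(m v : ℤ)) := by
      rw [map_pow, hu, ← WithZero.exp_nsmul]
      simp
    rw [HeightOneSpectrum.valuation_of_algebraMap, ← h2]
    have h3 : c = u v ^ m v + (c - u v ^ m v) := by ring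
    rw [h3]
    refine Valuation.map_add_eq_of_lt_left _ ?_
    rw [h2]
    refine h1.trans_lt ?_
    rw [WithZero.exp_lt_exp]
    push_cast
    omega
  refine ⟨c, ?_, key⟩
  rintro rfl
  obtain ⟨v, hv⟩ := Set.nonempty_iff_ne_empty.2 hemp
  have := key v hv
  simp at this
  exact WithZero.exp_ne_zero this.symm

end NumberFields

section FieldLemmas

variable {K L : Type*} [Field K] [Field L] [Algebra K L]

theorem mem_integers_of_pow_eq {p : ℕ} (hp : p ≠ 0) {x : L} {b : 𝓞 K}
    (hx : x ^ p = algebraMap K L (algebraMap (𝓞 K) K b)) : ∃ y : 𝓞 L, algebraMap (𝓞 L) L y = x := by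
  have hint : IsIntegral ℤ (x ^ p) := by
    rw [hx]
    exact b.isIntegral_coe.algebraMap
  exact ⟨⟨x, hint.of_pow (Nat.pos_of_ne_zero hp)⟩, rfl⟩

theorem adjoin_pow_eq_top {p n : ℕ} (hp : p ≠ 0) (hnp : n.Coprime p) {ω : L} {w c : K} (hw0 : w ≠ 0)
    (hc : c ≠ 0) (hw : ω ^ p = algebraMap K L w) (hL : IntermediateField.adjoin K {ω} = ⊤) :
    IntermediateField.adjoin K {(algebraMap K L c * ω) ^ n} = ⊤ := by
  rw [eq_top_iff, ← hL, IntermediateField.adjoin_simple_le_iff]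
  set F := IntermediateField.adjoin K {(algebraMap K L c * ω) ^ n} with hF
  have hc' : algebraMap K L c ≠ 0 := by simpa using hc
  have hω0 : ω ≠ 0 := by
    rintro rfl
    rw [zero_pow hp] at hw
    exact hw0 (by simpa using hw.symm)
  have h1 : (algebraMap K L c * ω) ^ n ∈ F := IntermediateField.mem_adjoin_simple_self K _
  have h2 : (algebraMap K L c * ω) ^ p ∈ F := by
    rw [mul_pow, hw, ← map_pow, ← map_mul]
    exact F.algebraMap_mem _
  have h3 : algebraMap K L c * ω ∈ F := by
    have hb := Nat.gcd_eq_gcd_ab n p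
    rw [hnp] at hb
    have : algebraMap K L c * ω = ((algebraMap K L c * ω) ^ n) ^ (n.gcdA p) *
        ((algebraMap K L c * ω) ^ p) ^ (n.gcdB p) := by
      rw [← zpow_natCast, ← zpow_natCast, ← zpow_mul, ← zpow_mul,
        ← zpow_add₀ (mul_ne_zero hc' hω0), ← hb]
      simp
    rw [this]
    exact mul_mem (zpow_mem h1 _) (zpow_mem h2 _)
  have h4 : ω = algebraMap K L c⁻¹ * (algebraMap K L c * ω) := by
    rw [map_inv₀, inv_mul_cancel_left₀ hc']
  rw [h4]
  exact mul_mem (F.algebraMap_mem _) h3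

end FieldLemmas

section Radicals

variable {K L : Type*} [Field K] [NumberField K] [Field L] [NumberField L] [Algebra K L]

theorem span_natCast_ne_zero {p : ℕ} (hp : p.Prime) : Ideal.span {(p : 𝓞 K)} ≠ 0 := by
  simpa using hp.ne_zero

theorem finite_setOf_natCast_mem {p : ℕ} (hp : p.Prime) :
    {v : HeightOneSpectrum (𝓞 K) | (p : 𝓞 K) ∈ v.asIdeal}.Finite := by
  have := Ideal.finite_factors (span_natCast_ne_zero (K := K) hp)
  simpa [Ideal.dvd_span_singleton] using this

/-- In a tame radical extension, `ω` can be scaled by an element of `K` in such a way that `ω ^ p`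
becomes an algebraic integer prime to `p`. -/
theorem exists_scaled_radicand (htame : IsTame K L) {p : ℕ} (hp : p.Prime) {ω : L} {w : K}
    (hw : ω ^ p = algebraMap K L w) (hw0 : w ≠ 0) :
    ∃ (c : K) (b : 𝓞 K), c ≠ 0 ∧ c ^ p * w = algebraMap (𝓞 K) K b ∧
      ∀ v : HeightOneSpectrum (𝓞 K), (p : 𝓞 K) ∈ v.asIdeal → b ∉ v.asIdeal := by
  obtain ⟨q, s, hs, hqs⟩ := IsFractionRing.div_surjective (A := 𝓞 K) w
  have hs0 : (algebraMap (𝓞 K) K s) ≠ 0 := by simpa using nonZeroDivisors.ne_zero hs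
  -- replace `w` by an algebraic integer
  obtain ⟨w₁, hw₁⟩ : ∃ w₁ : 𝓞 K, (algebraMap (𝓞 K) K w₁) = (algebraMap (𝓞 K) K s) ^ p * w := by
    refine ⟨s ^ (p - 1) * q, ?_⟩
    rw [← hqs, map_mul, map_pow]
    field_simp
    rw [mul_right_comm, ← pow_succ, Nat.sub_add_cancel hp.one_le, mul_comm]
  have hw₁0 : (algebraMap (𝓞 K) K w₁) ≠ 0 := by rw [hw₁]; exact mul_ne_zero (pow_ne_zero _ hs0) hw0
  have hdiv : ∀ v : HeightOneSpectrum (𝓞 K), ∃ m : ℕ, (p : 𝓞 K) ∈ v.asIdeal →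
      v.valuation K (algebraMap (𝓞 K) K w₁) = WithZero.exp (-(m : ℤ)) ^ p := by
    intro v
    by_cases hv : (p : 𝓞 K) ∈ v.asIdeal
    swap
    · exact ⟨0, fun h => absurd h hv⟩
    obtain ⟨u, e, hpe, hu⟩ := exists_valuation_extension_of_isTame htame hp v hv
    have h1 : u.valuation L (algebraMap K L (algebraMap (𝓞 K) K s) * ω) ^ p =
        v.valuation K (algebraMap (𝓞 K) K w₁) ^ e := by
      rw [← hu, ← map_pow, mul_pow, hw, hw₁, map_mul (algebraMap K L), map_pow (algebraMap K L)]
    have h2 := log_eq_of_pow_eq_pow h1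
    have h3 : (p : ℤ) ∣ WithZero.log (v.valuation K (algebraMap (𝓞 K) K w₁)) := by
      have hcop : IsCoprime (p : ℤ) e :=
        Nat.isCoprime_iff_coprime.2 ((hp.coprime_iff_not_dvd).2 hpe)
      exact hcop.dvd_of_dvd_mul_left ⟨_, h2.symm⟩
    obtain ⟨k, hk⟩ := h3
    have hv0 : v.valuation K (algebraMap (𝓞 K) K w₁) ≠ 0 := (Valuation.ne_zero_iff _).2 hw₁0
    have hle : WithZero.log (v.valuation K (algebraMap (𝓞 K) K w₁)) ≤ 0 := by
      rw [WithZero.log_le_iff_le_exp hv0]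
      simpa using v.valuation_le_one w₁
    have hk0 : k ≤ 0 := by
      have : (0 : ℤ) < p := by exact_mod_cast hp.pos
      by_contra hk0
      rw [hk] at hle
      nlinarith
    refine ⟨k.natAbs, fun _ => ?_⟩
    rw [← WithZero.exp_log hv0, hk, ← WithZero.exp_nsmul]
    congr 1
    rw [nsmul_eq_mul, Int.natCast_natAbs, abs_of_nonpos hk0, neg_neg]
  choose m hm using hdiv
  obtain ⟨c, hc0, hc⟩ := exists_valuation_eq_of_finite
    {v : HeightOneSpectrum (𝓞 K) | (p : 𝓞 K) ∈ v.asIdeal} (finite_setOf_natCast_mem hp) m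
  have hcK : (algebraMap (𝓞 K) K c) ≠ 0 := by simpa using hc0
  have hunit : ∀ v : HeightOneSpectrum (𝓞 K), (p : 𝓞 K) ∈ v.asIdeal →
      v.valuation K ((algebraMap (𝓞 K) K w₁) / (algebraMap (𝓞 K) K c) ^ p) = 1 := by
    intro v hv
    rw [map_div₀, map_pow, hm v hv, hc v hv]
    exact div_self (pow_ne_zero _ WithZero.exp_ne_zero)
  obtain ⟨d, b, hdb, hd⟩ := exists_denominator_prime_to hp.ne_zero fun v hv => (hunit v hv).le
  have hd1 : ∀ v : HeightOneSpectrum (𝓞 K), (p : 𝓞 K) ∈ v.asIdeal →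
      v.valuation K (algebraMap (𝓞 K) K d) = 1 :=
    fun v hv => v.valuation_eq_one_iff_notMem.2 (hd v hv)
  by_cases hex : ∃ v : HeightOneSpectrum (𝓞 K), (p : 𝓞 K) ∈ v.asIdeal
  swap
  · exact ⟨algebraMap (𝓞 K) K s, w₁, hs0, hw₁.symm, fun v hv => absurd ⟨v, hv⟩ hex⟩
  have hdK : (algebraMap (𝓞 K) K d) ≠ 0 := by
    obtain ⟨v, hv⟩ := hex
    intro h
    simpa [h] using hd1 v hv
  have hfin : (algebraMap (𝓞 K) K d * algebraMap (𝓞 K) K s / algebraMap (𝓞 K) K c) ^ p * w =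
      algebraMap (𝓞 K) K (d ^ (p - 1) * b) := by
    rw [map_mul, map_pow, ← hdb, hw₁, div_pow, mul_pow]
    have : (algebraMap (𝓞 K) K d) ^ p = (algebraMap (𝓞 K) K d) ^ (p - 1) * d := by
      rw [← pow_succ, Nat.sub_add_cancel hp.one_le]
    rw [this]
    ring
  refine ⟨_, d ^ (p - 1) * b, ?_, hfin, fun v hv => ?_⟩
  · exact div_ne_zero (mul_ne_zero hdK hs0) hcK
  rw [← v.valuation_eq_one_iff_notMem (K := K), map_mul, map_pow, map_mul, map_pow, hd1 v hv,
    ← hdb, map_mul, hd1 v hv, hunit v hv]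
  simp

/-- The group of units of `𝓞 K / p` has order prime to `p` if `p` is unramified in `K`. -/
theorem exists_pow_sub_one_dvd {p : ℕ} (hp : p.Prime)
    (hunr : Algebra.IsUnramifiedIn (𝓞 K) (Ideal.span {(p : ℤ)})) {b : 𝓞 K}
    (hb : ∀ v : HeightOneSpectrum (𝓞 K), (p : 𝓞 K) ∈ v.asIdeal → b ∉ v.asIdeal) :
    ∃ n : ℕ, n.Coprime p ∧ (p : 𝓞 K) ∣ b ^ n - 1 := by
  classical
  have := Fact.mk hp
  let R := 𝓞 K ⧸ Ideal.span {(p : 𝓞 K)}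
  have hfin : Finite R := Ideal.finiteQuotientOfFreeOfNeBot _ (span_natCast_ne_zero hp)
  have : Fintype R := Fintype.ofFinite R
  have hpR : (p : R) = 0 := by
    have : (p : R) = Ideal.Quotient.mk _ (p : 𝓞 K) := by simp [R]
    rw [this, Ideal.Quotient.eq_zero_iff_mem]
    exact Ideal.mem_span_singleton_self _
  refine ⟨Fintype.card Rˣ, ?_, ?_⟩
  · rw [Nat.coprime_comm, hp.coprime_iff_not_dvd]
    intro hdvd
    obtain ⟨u, hu⟩ := exists_prime_orderOf_dvd_card p hdvd
    obtain ⟨x, hx⟩ := Ideal.Quotient.mk_surjective (u : R)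
    have hu1 : u ^ p = 1 := by
      rw [← pow_orderOf_eq_one u, hu]
    obtain ⟨r, hr⟩ := exists_add_pow_prime_eq hp (x - 1) 1
    have hx1 : (p : 𝓞 K) ∣ x ^ p - 1 := by
      rw [← Ideal.mem_span_singleton, ← Ideal.Quotient.eq_zero_iff_mem, map_sub, map_pow, hx,
        map_one, ← Units.val_pow_eq_pow_val, hu1]
      simp
    have hx2 : (p : 𝓞 K) ∣ (x - 1) ^ p := by
      rw [sub_add_cancel] at hr
      have : (x - 1) ^ p = (x ^ p - 1) - p * ((x - 1) * r) := by rw [hr]; ring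
      rw [this]
      exact dvd_sub hx1 (dvd_mul_right _ _)
    have hx3 : (p : 𝓞 K) ^ 1 ∣ x - 1 := by
      refine natCast_pow_dvd_of_valuation_le hp hunr fun v hv => ?_
      refine le_exp_neg_one_of_lt_one ((v.valuation_lt_one_iff_mem _).2 ?_)
      exact v.isPrime.mem_of_pow_mem p (Ideal.mem_of_dvd _ hx2 hv)
    have hu2 : u = 1 := by
      ext
      rw [← hx, Units.val_one, ← map_one (Ideal.Quotient.mk _), Ideal.Quotient.eq,
        Ideal.mem_span_singleton]
      simpa using hx3
    rw [hu2, orderOf_one] at hu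
    exact hp.one_lt.ne hu
  · have hbu : IsUnit (Ideal.Quotient.mk (Ideal.span {(p : 𝓞 K)}) b) := by
      have htop : Ideal.span {b} ⊔ Ideal.span {(p : 𝓞 K)} = ⊤ := by
        by_contra hne
        obtain ⟨M, hM, hle⟩ := Ideal.exists_le_maximal _ hne
        have hpM : (p : 𝓞 K) ∈ M := hle (Ideal.mem_sup_right (Ideal.mem_span_singleton_self _))
        have hM0 : M ≠ ⊥ := by
          rintro rfl
          exact hp.ne_zero (by exact_mod_cast (Ideal.mem_bot.1 hpM))
        exact hb ⟨M, hM.isPrime, hM0⟩ hpM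
          (hle (Ideal.mem_sup_left (Ideal.mem_span_singleton_self _)))
      obtain ⟨y, hy, q, hq, hyq⟩ := Submodule.mem_sup.1 ((Ideal.eq_top_iff_one _).1 htop)
      obtain ⟨z, rfl⟩ := Ideal.mem_span_singleton'.1 hy
      refine IsUnit.of_mul_eq_one (Ideal.Quotient.mk _ z) ?_
      rw [← map_mul, ← map_one (Ideal.Quotient.mk _), eq_comm, Ideal.Quotient.eq, ← hyq]
      rwa [mul_comm b z, add_sub_cancel_left]
    obtain ⟨u, hu⟩ := hbu
    rw [← Ideal.mem_span_singleton, ← Ideal.Quotient.eq_zero_iff_mem, map_sub, map_pow, ← hu,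
      ← Units.val_pow_eq_pow_val]
    have : u ^ Fintype.card Rˣ = 1 := pow_card_eq_one
    rw [this]
    simp

/-- In a tame extension, a `p`-th power lying in `K` that is congruent to `1` modulo `p` is
congruent to `1` modulo `p ^ 2`. -/
theorem natCast_sq_dvd_of_isTame (htame : IsTame K L) {p : ℕ} (hp : p.Prime)
    (hunr : Algebra.IsUnramifiedIn (𝓞 K) (Ideal.span {(p : ℤ)})) {α : 𝓞 L} {a : 𝓞 K}
    (hα : α ^ p = algebraMap (𝓞 K) (𝓞 L) a) (ha : (p : 𝓞 K) ∣ a - 1) :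
    (p : 𝓞 K) ^ 2 ∣ a - 1 := by
  refine natCast_pow_dvd_of_valuation_le hp hunr fun v hv => ?_
  have hv1 : v.valuation K (algebraMap (𝓞 K) K (a - 1)) ≤ WithZero.exp (-1 : ℤ) :=
    le_exp_neg_one_of_lt_one ((v.valuation_lt_one_iff_mem _).2 (Ideal.mem_of_dvd _ ha hv))
  by_contra hv2
  have hv3 : v.valuation K (algebraMap (𝓞 K) K (a - 1)) = WithZero.exp (-1 : ℤ) := by
    refine le_antisymm hv1 ?_
    have h0 : v.valuation K (algebraMap (𝓞 K) K (a - 1)) ≠ 0 := by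
      intro h0
      rw [h0] at hv2
      exact hv2 zero_le
    rw [← WithZero.log_le_iff_le_exp h0] at hv2
    rw [← WithZero.le_log_iff_exp_le h0]
    rw [Nat.cast_ofNat] at hv2
    omega
  obtain ⟨w, e, hpe, hw⟩ := exists_valuation_extension_of_isTame htame hp v hv
  have hwp : w.valuation L (p : L) = WithZero.exp (-1 : ℤ) ^ e := by
    rw [← valuation_natCast_of_isUnramifiedIn hp hunr v hv, ← hw, map_natCast (algebraMap K L)]
  have hwa : w.valuation L (algebraMap (𝓞 L) L (α ^ p - 1)) = WithZero.exp (-1 : ℤ) ^ e := by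
    rw [← hv3, ← hw, hα]
    congr 1
    simp only [map_sub, map_one, ← IsScalarTower.algebraMap_apply]
  have he : e ≠ 0 := fun h => hpe (h ▸ dvd_zero p)
  have hlt : WithZero.exp (-1 : ℤ) ^ e < (1 : WithZero (Multiplicative ℤ)) := by
    refine pow_lt_one₀ zero_le ?_ he
    rw [← WithZero.exp_zero, WithZero.exp_lt_exp]
    norm_num
  obtain ⟨r, hr⟩ := exists_add_pow_prime_eq hp (α - 1) 1
  rw [sub_add_cancel] at hr
  have hδ : (α - 1) ^ p = (α ^ p - 1) + (-(p * ((α - 1) * r))) := by rw [hr]; ring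
  have hwpm : (p : 𝓞 L) ∈ w.asIdeal := by
    rw [← w.valuation_lt_one_iff_mem (K := L)]
    simpa [hwp] using hlt
  have hδm : α - 1 ∈ w.asIdeal := by
    refine w.isPrime.mem_of_pow_mem p ?_
    rw [hδ]
    refine add_mem ?_ (neg_mem (Ideal.mul_mem_right _ _ hwpm))
    rw [← w.valuation_lt_one_iff_mem (K := L), hwa]
    exact hlt
  have hsmall : w.valuation L (algebraMap (𝓞 L) L (-(p * ((α - 1) * r)))) <
      w.valuation L (algebraMap (𝓞 L) L (α ^ p - 1)) := by
    rw [hwa, map_neg, Valuation.map_neg, map_mul, map_natCast, map_mul, hwp]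
    refine mul_lt_of_lt_one_right (zero_lt_iff.2 (pow_ne_zero _ WithZero.exp_ne_zero)) ?_
    exact (w.valuation_lt_one_iff_mem _).2 (Ideal.mul_mem_right _ _ hδm)
  have hfin : w.valuation L (algebraMap (𝓞 L) L (α - 1)) ^ p = WithZero.exp (-1 : ℤ) ^ e := by
    rw [← map_pow, ← map_pow, hδ, map_add, Valuation.map_add_eq_of_lt_left _ hsmall, hwa]
  have := log_eq_of_pow_eq_pow hfin
  rw [WithZero.log_exp] at this
  have hdvd : (p : ℤ) ∣ e :=
    ⟨-WithZero.log (w.valuation L (algebraMap (𝓞 L) L (α - 1))), by linarith⟩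
  exact hpe (by exact_mod_cast hdvd)

theorem exists_radical_generator (htame : IsTame K L) {p : ℕ} (hp : p.Prime)
    (hunr : Algebra.IsUnramifiedIn (𝓞 K) (Ideal.span {(p : ℤ)})) {ω : L} {w : K} (hw0 : w ≠ 0)
    (hw : ω ^ p = algebraMap K L w) (hL : IntermediateField.adjoin K {ω} = ⊤) :
    ∃ (α : 𝓞 L) (a : 𝓞 K), IntermediateField.adjoin K {algebraMap (𝓞 L) L α} = ⊤ ∧
      α ^ p = algebraMap (𝓞 K) (𝓞 L) a ∧ (p : 𝓞 K) ^ 2 ∣ a - 1 := by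
  obtain ⟨c, b, hc, hcb, hb⟩ := exists_scaled_radicand htame hp hw hw0
  obtain ⟨n, hn, hdvd⟩ := exists_pow_sub_one_dvd hp hunr hb
  have hpow : ((algebraMap K L c * ω) ^ n) ^ p = algebraMap K L (algebraMap (𝓞 K) K (b ^ n)) := by
    rw [← pow_mul, mul_comm n, pow_mul, mul_pow, hw, ← map_pow, ← map_mul, hcb, map_pow, map_pow]
  obtain ⟨α, hα⟩ := mem_integers_of_pow_eq hp.ne_zero hpow
  have hαp : α ^ p = algebraMap (𝓞 K) (𝓞 L) (b ^ n) := by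
    apply FaithfulSMul.algebraMap_injective (𝓞 L) L
    rw [map_pow, hα, hpow, ← IsScalarTower.algebraMap_apply, ← IsScalarTower.algebraMap_apply]
  refine ⟨α, b ^ n, ?_, hαp, natCast_sq_dvd_of_isTame htame hp hunr hαp hdvd⟩
  rw [hα]
  exact adjoin_pow_eq_top hp.ne_zero hn hw0 hc hw hL

end Radicals

section Kummer

variable {K L E : Type*} [Field K] [Field L] [Field E] [Algebra K L] [Algebra L E] [Algebra K E]
  [IsScalarTower K L E]

/-- The data of a radical extension `L = K(α)` with `α ^ p = a`, an automorphism `σ` of `E` with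
`σ α = ζ α` and the associated permutation `η` of `G / G'`. -/
structure IsRadicalDatum (p : ℕ) (α : L) (a : K) (ζ : E) (σ : E ≃ₐ[K] E)
    (η : Equiv.Perm (CosetSpace K L E)) : Prop where
  prime : p.Prime
  prim : IsPrimitiveRoot ζ p
  ne_zero : α ≠ 0
  pow_eq : α ^ p = algebraMap K L a
  adjoin_eq : IntermediateField.adjoin K {α} = ⊤
  fixes : σ ζ = ζ
  map_eq : σ (algebraMap L E α) = ζ * algebraMap L E α
  perm_eq : ∀ i : ℤ, η (QuotientGroup.mk (σ ^ i)) = QuotientGroup.mk (σ ^ (i - 1))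

/-- The factor by which the permutation `n` changes the conjugates of `α`. -/
def rootFactor (α : L) (n : Equiv.Perm (CosetSpace K L E)) : E :=
  cosetEval α (n (QuotientGroup.mk 1)) / algebraMap L E α

theorem cosetEval_pow (x : L) (k : ℕ) (y : CosetSpace K L E) :
    cosetEval (x ^ k) y = cosetEval x y ^ k := by
  induction y using QuotientGroup.induction_on with
  | H z => simp

theorem exists_eq_sum_pow {p : ℕ} (hp : p ≠ 0) {α : L} {a : K} (hα : α ^ p = algebraMap K L a)
    (hL : IntermediateField.adjoin K {α} = ⊤) (z : L) :
    ∃ q : ℕ → K, z = ∑ j ∈ Finset.range p, q j • α ^ j := by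
  have hint : IsIntegral K α :=
    IsIntegral.of_pow (Nat.pos_of_ne_zero hp) (hα ▸ isIntegral_algebraMap)
  have hz : z ∈ Algebra.adjoin K {α} := by
    rw [← IntermediateField.adjoin_simple_toSubalgebra_of_isAlgebraic hint.isAlgebraic, hL]
    trivial
  rw [Algebra.adjoin_singleton_eq_range_aeval] at hz
  obtain ⟨f, rfl⟩ := hz
  have hmon : (Polynomial.X ^ p - Polynomial.C a).Monic := Polynomial.monic_X_pow_sub_C a hp
  have hroot : Polynomial.aeval α (Polynomial.X ^ p - Polynomial.C a) = 0 := by simp [hα]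
  refine ⟨fun j => (f %ₘ (Polynomial.X ^ p - Polynomial.C a)).coeff j, ?_⟩
  change Polynomial.aeval α f = _
  rw [← Polynomial.aeval_modByMonic_eq_self_of_root hroot]
  refine Polynomial.aeval_eq_sum_range' ?_ α
  have := Polynomial.natDegree_modByMonic_lt f hmon (by
    intro h
    have := congrArg Polynomial.natDegree h
    rw [Polynomial.natDegree_X_pow_sub_C, Polynomial.natDegree_one] at this
    exact hp this)
  rwa [Polynomial.natDegree_X_pow_sub_C] at this

theorem geom_sum_of_pow_eq_one {F : Type*} [Field F] {p : ℕ} {r : F} (hr : r ^ p = 1)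
    (hr1 : r ≠ 1) : ∑ j ∈ Finset.range p, r ^ j = 0 := by
  have := mul_neg_geom_sum r p
  rw [hr, sub_self] at this
  exact (mul_eq_zero.1 this).resolve_left (sub_ne_zero.2 hr1.symm)

theorem galAct_single (g : E ≃ₐ[K] E) (n : Equiv.Perm (CosetSpace K L E)) (c : E) :
    galAct K L E g (MonoidAlgebra.single n c) =
      MonoidAlgebra.single (leftTranslation K L E g * n * (leftTranslation K L E g)⁻¹) (g c) := by
  simp [galAct]

theorem permRep_inclPerm {N : Subgroup (Equiv.Perm (CosetSpace K L E))} (h : MonoidAlgebra E N)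
    (f : CosetSpace K L E → E) (y : CosetSpace K L E) :
    permRep K L E (inclPerm (K := K) N h) f y = h.coeff.sum fun n c =>
      c * f ((n : Equiv.Perm (CosetSpace K L E))⁻¹ y) := by
  induction h using MonoidAlgebra.induction_linear with
  | zero => simp
  | add a b ha hb =>
    rw [map_add, map_add, LinearMap.add_apply, Pi.add_apply, ha, hb, MonoidAlgebra.coeff_add,
      Finsupp.sum_add_index'] <;> simp [add_mul]
  | single n c =>
    have : inclPerm (K := K) N (MonoidAlgebra.single n c) =
        MonoidAlgebra.single (n : Equiv.Perm (CosetSpace K L E)) c := by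
      simp [inclPerm]
    rw [this, permRep_single]
    simp

namespace IsRadicalDatum

variable {p : ℕ} {α : L} {a : K} {ζ : E} {σ : E ≃ₐ[K] E} {η : Equiv.Perm (CosetSpace K L E)}

theorem algebraMap_ne_zero (D : IsRadicalDatum p α a ζ σ η) : algebraMap L E α ≠ 0 := by
  simpa using D.ne_zero

theorem natCast_ne_zero (D : IsRadicalDatum p α a ζ σ η)
    [CharZero K] : (p : K) ≠ 0 := by exact_mod_cast D.prime.ne_zero

theorem pow_pow_eq (D : IsRadicalDatum p α a ζ σ η)
    (k : ℕ) : (α ^ k) ^ p = algebraMap K L (a ^ k) := by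
  rw [← pow_mul, mul_comm, pow_mul, D.pow_eq, map_pow]

theorem radicand_ne_zero (D : IsRadicalDatum p α a ζ σ η) : a ≠ 0 := by
  intro h
  have := D.pow_eq
  rw [h, map_zero] at this
  exact D.ne_zero (eq_zero_of_pow_eq_zero this)

theorem zpow_map_eq (D : IsRadicalDatum p α a ζ σ η)
    (i : ℤ) : (σ ^ i) (algebraMap L E α) = ζ ^ i * algebraMap L E α := by
  have hnat : ∀ k : ℕ, (σ ^ k) (algebraMap L E α) = ζ ^ k * algebraMap L E α := by
    intro k
    induction k with
    | zero => simp
    | succ k ih =>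
      rw [pow_succ', AlgEquiv.mul_apply, ih, map_mul, map_pow, D.fixes, D.map_eq, pow_succ]
      ring
  have hfix : ∀ k : ℕ, (σ ^ k) ζ = ζ := by
    intro k
    induction k with
    | zero => simp
    | succ k ih => rw [pow_succ', AlgEquiv.mul_apply, ih, D.fixes]
  have hζ0 : ζ ≠ 0 := D.prim.ne_zero D.prime.ne_zero
  obtain ⟨k, rfl | rfl⟩ := i.eq_nat_or_neg
  · simpa using hnat k
  · have h1 : (σ ^ k) (ζ ^ (-(k : ℤ)) * algebraMap L E α) = algebraMap L E α := by
      rw [map_mul, map_zpow₀, hfix, hnat, ← mul_assoc, ← zpow_natCast ζ k, ← zpow_add₀ hζ0]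
      simp
    rw [zpow_neg, zpow_natCast]
    conv_lhs => rw [← h1]
    rw [← AlgEquiv.mul_apply, inv_mul_cancel, AlgEquiv.one_apply]

theorem cosetEval_injective_right (D : IsRadicalDatum p α a ζ σ η) :
    Function.Injective (cosetEval α : CosetSpace K L E → E) := by
  intro y y' h
  induction y using QuotientGroup.induction_on with
  | H g =>
  induction y' using QuotientGroup.induction_on with
  | H g' =>
  rw [cosetEval_mk, cosetEval_mk] at h
  rw [QuotientGroup.eq]
  refine (IntermediateField.mem_fixingSubgroup_iff _ _).2 ?_
  rintro _ ⟨z, rfl⟩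
  obtain ⟨q, rfl⟩ := exists_eq_sum_pow D.prime.ne_zero D.pow_eq D.adjoin_eq z
  have h1 : (g⁻¹ * g') (algebraMap L E α) = algebraMap L E α := by
    rw [AlgEquiv.mul_apply, ← h, ← AlgEquiv.mul_apply, inv_mul_cancel, AlgEquiv.one_apply]
  change (g⁻¹ * g') (algebraMap L E _) = algebraMap L E _
  simp only [map_sum]
  refine Finset.sum_congr rfl fun j _ => ?_
  rw [Algebra.smul_def, map_mul, map_pow, ← IsScalarTower.algebraMap_apply, map_mul, map_pow, h1,
    AlgEquiv.commutes]

theorem cosetEval_ne_zero (D : IsRadicalDatum p α a ζ σ η)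
    (y : CosetSpace K L E) : cosetEval α y ≠ 0 := by
  induction y using QuotientGroup.induction_on with
  | H g => simpa using D.ne_zero

theorem exists_zpow_of_pow_eq_one (D : IsRadicalDatum p α a ζ σ η)
    {r : E} (hr : r ^ p = 1) : ∃ i : ℤ, r = ζ ^ i := by
  have : NeZero p := ⟨D.prime.ne_zero⟩
  obtain ⟨i, -, hi⟩ := D.prim.eq_pow_of_pow_eq_one hr
  exact ⟨i, by rw [zpow_natCast, hi]⟩

theorem exists_eq_mk_zpow (D : IsRadicalDatum p α a ζ σ η)
    (y : CosetSpace K L E) : ∃ i : ℤ, y = QuotientGroup.mk (σ ^ i) := by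
  have h1 : (cosetEval α y / algebraMap L E α) ^ p = 1 := by
    rw [div_pow, div_eq_one_iff_eq (pow_ne_zero _ D.algebraMap_ne_zero)]
    induction y using QuotientGroup.induction_on with
    | H g =>
      rw [cosetEval_mk, ← map_pow, ← map_pow, D.pow_eq, ← IsScalarTower.algebraMap_apply,
        AlgEquiv.commutes]
  obtain ⟨i, hi⟩ := D.exists_zpow_of_pow_eq_one h1
  refine ⟨i, D.cosetEval_injective_right ?_⟩
  rw [cosetEval_mk, D.zpow_map_eq, ← hi, div_mul_cancel₀ _ D.algebraMap_ne_zero]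

theorem cosetEval_perm (D : IsRadicalDatum p α a ζ σ η)
    (y : CosetSpace K L E) : cosetEval α (η y) = ζ⁻¹ * cosetEval α y := by
  obtain ⟨i, rfl⟩ := D.exists_eq_mk_zpow y
  rw [D.perm_eq, cosetEval_mk, cosetEval_mk, D.zpow_map_eq, D.zpow_map_eq,
    zpow_sub_one₀ (D.prim.ne_zero D.prime.ne_zero)]
  ring

theorem cosetEval_perm_zpow (D : IsRadicalDatum p α a ζ σ η) (i : ℤ) (y : CosetSpace K L E) :
    cosetEval α ((η ^ i) y) = ζ ^ (-i) * cosetEval α y := by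
  have hζ0 : ζ ≠ 0 := D.prim.ne_zero D.prime.ne_zero
  induction i generalizing y with
  | zero => simp
  | succ k ih =>
    rw [zpow_add_one, Equiv.Perm.mul_apply, ih, D.cosetEval_perm, neg_add, zpow_add₀ hζ0,
      zpow_neg_one, mul_assoc]
  | pred k ih =>
    have h1 := D.cosetEval_perm (η⁻¹ y)
    rw [show η (η⁻¹ y) = y from η.apply_symm_apply y, eq_inv_mul_iff_mul_eq₀ hζ0] at h1
    rw [zpow_sub_one, Equiv.Perm.mul_apply, ih, ← h1, neg_sub, sub_eq_neg_add, add_comm,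
      add_comm, zpow_add₀ hζ0, zpow_one, mul_assoc]

theorem mem_zpowers_iff (D : IsRadicalDatum p α a ζ σ η) {n : Equiv.Perm (CosetSpace K L E)} :
    n ∈ Subgroup.zpowers η ↔
      ∃ r : E, r ^ p = 1 ∧ ∀ y, cosetEval α (n y) = r * cosetEval α y := by
  constructor
  · rintro ⟨i, rfl⟩
    refine ⟨ζ ^ (-i), ?_, D.cosetEval_perm_zpow i⟩
    rw [← zpow_natCast, ← zpow_mul, mul_comm, zpow_mul, zpow_natCast, D.prim.pow_eq_one, one_zpow]
  · rintro ⟨r, hr, hn⟩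
    obtain ⟨i, rfl⟩ := D.exists_zpow_of_pow_eq_one hr
    refine ⟨-i, Equiv.ext fun y => D.cosetEval_injective_right ?_⟩
    rw [hn, D.cosetEval_perm_zpow, neg_neg]

theorem rootFactor_spec (D : IsRadicalDatum p α a ζ σ η)
    {n : Equiv.Perm (CosetSpace K L E)} (hn : n ∈ Subgroup.zpowers η) :
    rootFactor α n ^ p = 1 ∧ ∀ y, cosetEval α (n y) = rootFactor α n * cosetEval α y := by
  obtain ⟨r, hr, h⟩ := D.mem_zpowers_iff.1 hn
  have : rootFactor α n = r := by
    rw [rootFactor, h, cosetEval_mk, AlgEquiv.one_apply,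
      mul_div_cancel_right₀ _ D.algebraMap_ne_zero]
  rw [this]
  exact ⟨hr, h⟩

theorem rootFactor_eq (D : IsRadicalDatum p α a ζ σ η)
    {n : Equiv.Perm (CosetSpace K L E)} {r : E} (y : CosetSpace K L E)
    (hn : n ∈ Subgroup.zpowers η) (h : cosetEval α (n y) = r * cosetEval α y) :
    rootFactor α n = r := by
  rw [(D.rootFactor_spec hn).2] at h
  exact mul_right_cancel₀ (D.cosetEval_ne_zero y) h

theorem rootFactor_ne_zero (D : IsRadicalDatum p α a ζ σ η)
    {n : Equiv.Perm (CosetSpace K L E)} (hn : n ∈ Subgroup.zpowers η) :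
    rootFactor α n ≠ 0 := by
  intro h
  have := (D.rootFactor_spec hn).1
  rw [h, zero_pow D.prime.ne_zero] at this
  exact zero_ne_one this

theorem cosetEval_inv (D : IsRadicalDatum p α a ζ σ η)
    {n : Equiv.Perm (CosetSpace K L E)} (hn : n ∈ Subgroup.zpowers η)
    (y : CosetSpace K L E) : cosetEval α (n⁻¹ y) = (rootFactor α n)⁻¹ * cosetEval α y := by
  have := (D.rootFactor_spec hn).2 (n⁻¹ y)
  rw [show n (n⁻¹ y) = y from n.apply_symm_apply y] at this
  rw [this, inv_mul_cancel_left₀ (D.rootFactor_ne_zero hn)]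

theorem rootFactor_injective (D : IsRadicalDatum p α a ζ σ η) {m n : Equiv.Perm (CosetSpace K L E)}
    (hm : m ∈ Subgroup.zpowers η) (hn : n ∈ Subgroup.zpowers η)
    (h : rootFactor α m = rootFactor α n) : m = n :=
  Equiv.ext fun y => D.cosetEval_injective_right (by
    rw [(D.rootFactor_spec hm).2, (D.rootFactor_spec hn).2, h])

theorem conj_mem (D : IsRadicalDatum p α a ζ σ η)
    (g : E ≃ₐ[K] E) {n : Equiv.Perm (CosetSpace K L E)}
    (hn : n ∈ Subgroup.zpowers η) :
    leftTranslation K L E g * n * (leftTranslation K L E g)⁻¹ ∈ Subgroup.zpowers η ∧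
      rootFactor α (leftTranslation K L E g * n * (leftTranslation K L E g)⁻¹) =
        g (rootFactor α n) := by
  have key : ∀ y, cosetEval α ((leftTranslation K L E g * n * (leftTranslation K L E g)⁻¹) y) =
      g (rootFactor α n) * cosetEval α y := by
    intro y
    have h1 : ∀ z, leftTranslation K L E g z = g • z := fun z => rfl
    have h2 : (leftTranslation K L E g)⁻¹ y = g⁻¹ • y := by rw [← map_inv]; rfl
    rw [Equiv.Perm.mul_apply, Equiv.Perm.mul_apply, h1, h2, cosetEval_smul,
      (D.rootFactor_spec hn).2, cosetEval_smul, map_mul, ← AlgEquiv.mul_apply g g⁻¹,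
      mul_inv_cancel, AlgEquiv.one_apply]
  have hmem : leftTranslation K L E g * n * (leftTranslation K L E g)⁻¹ ∈ Subgroup.zpowers η :=
    D.mem_zpowers_iff.2 ⟨_, by rw [← map_pow, (D.rootFactor_spec hn).1, map_one], key⟩
  exact ⟨hmem, D.rootFactor_eq (QuotientGroup.mk 1) hmem (key _)⟩

/-- Every radical generator of `L` defines a radical datum for a suitable root of unity. -/
theorem of_adjoin_eq_top (D : IsRadicalDatum p α a ζ σ η)
    {β : L} {b : K} (hL : IntermediateField.adjoin K {β} = ⊤)
    (hβ : β ^ p = algebraMap K L b) : ∃ ζ' : E, IsRadicalDatum p β b ζ' σ η := by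
  have hne : σ (algebraMap L E β) ≠ algebraMap L E β := by
    intro h
    obtain ⟨q, hq⟩ := exists_eq_sum_pow D.prime.ne_zero hβ hL α
    have h1 : σ (algebraMap L E α) = algebraMap L E α := by
      rw [hq]
      simp only [map_sum, Algebra.smul_def, map_mul, map_pow, h,
        ← IsScalarTower.algebraMap_apply K L E, AlgEquiv.commutes]
    rw [D.map_eq, mul_eq_right₀ D.algebraMap_ne_zero] at h1
    exact D.prim.ne_one D.prime.one_lt h1
  have hβ0 : β ≠ 0 := by
    rintro rfl
    simp at hne
  have hβ0' : algebraMap L E β ≠ 0 := by simpa using hβ0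
  have hpow : (σ (algebraMap L E β) / algebraMap L E β) ^ p = 1 := by
    rw [div_pow, div_eq_one_iff_eq (pow_ne_zero _ hβ0'), ← map_pow, ← map_pow, hβ,
      ← IsScalarTower.algebraMap_apply, AlgEquiv.commutes]
  have := Fact.mk D.prime
  refine ⟨σ (algebraMap L E β) / algebraMap L E β, D.prime, ?_, hβ0, hβ, hL, ?_, ?_, D.perm_eq⟩
  · exact IsPrimitiveRoot.iff_orderOf.2 (orderOf_eq_prime hpow fun h =>
      hne ((div_eq_one_iff_eq hβ0').1 h))
  · obtain ⟨i, hi⟩ := D.exists_zpow_of_pow_eq_one hpow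
    rw [hi, map_zpow₀, D.fixes]
  · rw [div_mul_cancel₀ _ hβ0']

theorem orderOf_perm (D : IsRadicalDatum p α a ζ σ η) : orderOf η = p := by
  have := Fact.mk D.prime
  refine orderOf_eq_prime ?_ ?_
  · refine Equiv.ext fun y => D.cosetEval_injective_right ?_
    rw [← zpow_natCast, D.cosetEval_perm_zpow, zpow_neg, zpow_natCast, D.prim.pow_eq_one]
    simp
  · intro h
    have h1 := D.cosetEval_perm (QuotientGroup.mk 1)
    rw [h, Equiv.Perm.one_apply, eq_comm, mul_eq_right₀ (D.cosetEval_ne_zero _), inv_eq_one] at h1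
    exact D.prim.ne_one D.prime.one_lt h1

theorem sum_rootFactor_pow (D : IsRadicalDatum p α a ζ σ η)
    [CharZero E] [Fintype (Subgroup.zpowers η)] {j k : ℕ} (hj : j < p)
    (hk : k < p) :
    ∑ n : Subgroup.zpowers η, rootFactor α n.1 ^ j * (rootFactor α n.1)⁻¹ ^ k =
      if j = k then (p : E) else 0 := by
  split_ifs with hjk
  · subst hjk
    have : ∀ n : Subgroup.zpowers η, rootFactor α n.1 ^ j * (rootFactor α n.1)⁻¹ ^ j = 1 := by
      intro n
      rw [← mul_pow, mul_inv_cancel₀ (D.rootFactor_ne_zero n.2), one_pow]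
    simp only [this, Finset.sum_const, Finset.card_univ, nsmul_eq_mul, mul_one]
    rw [← Nat.card_eq_fintype_card, Nat.card_zpowers, D.orderOf_perm]
  · set S := ∑ n : Subgroup.zpowers η, rootFactor α n.1 ^ j * (rootFactor α n.1)⁻¹ ^ k with hS
    have hηmem : η ∈ Subgroup.zpowers η := Subgroup.mem_zpowers η
    have hη : rootFactor α η = ζ⁻¹ :=
      D.rootFactor_eq (QuotientGroup.mk 1) hηmem (D.cosetEval_perm _)
    have hmul : ∀ n : Subgroup.zpowers η, rootFactor α (η * n.1) = ζ⁻¹ * rootFactor α n.1 := by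
      intro n
      refine D.rootFactor_eq (QuotientGroup.mk 1) (mul_mem hηmem n.2) ?_
      rw [Equiv.Perm.mul_apply, D.cosetEval_perm, (D.rootFactor_spec n.2).2, mul_assoc]
    have h1 : S = (ζ⁻¹ ^ j * ζ ^ k) * S := by
      conv_lhs => rw [hS, ← Equiv.sum_comp (Equiv.mulLeft (⟨η, hηmem⟩ : Subgroup.zpowers η))]
      rw [hS, Finset.mul_sum]
      refine Finset.sum_congr rfl fun n _ => ?_
      rw [Equiv.coe_mulLeft, Subgroup.coe_mul, hmul, mul_inv, inv_inv, mul_pow, mul_pow]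
      ring
    by_contra hS0
    have h2 : ζ⁻¹ ^ j * ζ ^ k = 1 := (mul_eq_right₀ hS0).1 h1.symm
    have hζ0 : ζ ≠ 0 := D.prim.ne_zero D.prime.ne_zero
    rw [inv_pow, inv_mul_eq_one₀ (pow_ne_zero _ hζ0)] at h2
    exact hjk (D.prim.pow_inj hj hk h2)

theorem permRep_cosetEval_pow (D : IsRadicalDatum p α a ζ σ η) [Fintype (Subgroup.zpowers η)]
    (h : MonoidAlgebra E (Subgroup.zpowers η)) (k : ℕ)
    (y : CosetSpace K L E) :
    permRep K L E (inclPerm (K := K) _ h) (cosetEval (α ^ k)) y =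
      (∑ n : Subgroup.zpowers η, h.coeff n * (rootFactor α n.1)⁻¹ ^ k) * cosetEval α y ^ k := by
  rw [permRep_inclPerm, Finsupp.sum_fintype _ _ (by simp), Finset.sum_mul]
  refine Finset.sum_congr rfl fun n _ => ?_
  rw [cosetEval_pow, D.cosetEval_inv n.2, mul_pow, mul_assoc]

theorem sum_range_rootFactor_div (D : IsRadicalDatum p α a ζ σ η)
    {m n : Equiv.Perm (CosetSpace K L E)}
    (hm : m ∈ Subgroup.zpowers η) (hn : n ∈ Subgroup.zpowers η) [Decidable (m = n)] :
    ∑ j ∈ Finset.range p, rootFactor α n ^ j * (rootFactor α m)⁻¹ ^ j =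
      if m = n then (p : E) else 0 := by
  simp only [← mul_pow]
  split_ifs with h
  · subst h
    simp [mul_inv_cancel₀ (D.rootFactor_ne_zero hm)]
  · refine geom_sum_of_pow_eq_one ?_ fun h1 => h (D.rootFactor_injective hm hn ?_)
    · rw [mul_pow, inv_pow, (D.rootFactor_spec hm).1, (D.rootFactor_spec hn).1, inv_one, mul_one]
    · exact ((mul_inv_eq_one₀ (D.rootFactor_ne_zero hm)).1 h1).symm

end IsRadicalDatum

section Spectral

variable [FiniteDimensional K E] {p : ℕ} {α : L} {a : K} {ζ : E} {σ : E ≃ₐ[K] E}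
  {η : Equiv.Perm (CosetSpace K L E)}

/-- The element of `E[N]` with eigenvalue `x j` on `α ^ j`. -/
def spectralElt (p : ℕ) (α : L) (η : Equiv.Perm (CosetSpace K L E)) (x : ℕ → K) :
    MonoidAlgebra E (Subgroup.zpowers η) :=
  MonoidAlgebra.ofCoeff (Finsupp.equivFunOnFinite.symm fun n =>
    (p : E)⁻¹ * ∑ j ∈ Finset.range p, algebraMap K E (x j) * rootFactor α n.1 ^ j)

theorem coeff_spectralElt (x : ℕ → K) (n : Subgroup.zpowers η) :
    (spectralElt p α η x).coeff n =
      (p : E)⁻¹ * ∑ j ∈ Finset.range p, algebraMap K E (x j) * rootFactor α n.1 ^ j := rfl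

theorem monoidAlgebra_eq_sum_single {R M : Type*} [Semiring R] [Fintype M]
    (h : MonoidAlgebra R M) : h = ∑ m, MonoidAlgebra.single m (h.coeff m) := by
  conv_lhs => rw [← MonoidAlgebra.sum_coeff_single h]
  exact Finsupp.sum_fintype _ _ (by simp)

theorem IsRadicalDatum.spectralElt_mem (D : IsRadicalDatum p α a ζ σ η) (x : ℕ → K) :
    spectralElt p α η x ∈ hopfAlg (Subgroup.zpowers η) := by
  have := Fintype.ofFinite (Subgroup.zpowers η)
  simp only [hopfAlg, permInvariants, Subalgebra.mem_comap, Algebra.mem_iInf]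
  intro g
  rw [AlgHom.mem_equalizer, AlgHom.id_apply]
  rw [monoidAlgebra_eq_sum_single (spectralElt p α η x), map_sum, map_sum]
  have hincl : ∀ (n : Subgroup.zpowers η) (c : E),
      inclPerm (K := K) (Subgroup.zpowers η) (MonoidAlgebra.single n c) =
        MonoidAlgebra.single n.1 c := by
    intro n c
    simp [inclPerm]
  simp only [hincl, galAct_single]
  let f : Subgroup.zpowers η → Subgroup.zpowers η := fun n => ⟨_, (D.conj_mem g n.2).1⟩
  have hf : Function.Bijective f := by
    refine Finite.injective_iff_bijective.1 fun m n hmn => ?_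
    have := congrArg Subtype.val hmn
    exact Subtype.ext (mul_left_cancel (mul_right_cancel this))
  rw [← hf.sum_comp fun n : Subgroup.zpowers η =>
    MonoidAlgebra.single n.1 ((spectralElt p α η x).coeff n)]
  refine Finset.sum_congr rfl fun n _ => ?_
  congr 1
  rw [coeff_spectralElt, coeff_spectralElt, (D.conj_mem g n.2).2]
  simp

namespace IsRadicalDatum

/-- The element of `H = E[N]^G` with eigenvalue `x j` on `α ^ j`. -/
def spectral (D : IsRadicalDatum p α a ζ σ η) (x : ℕ → K) : hopfAlg (Subgroup.zpowers η) :=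
  ⟨spectralElt p α η x, D.spectralElt_mem x⟩

theorem spectral_congr (D : IsRadicalDatum p α a ζ σ η) {x x' : ℕ → K} (h : ∀ j < p, x j = x' j) :
    D.spectral x = D.spectral x' := by
  refine Subtype.ext ?_
  ext n
  change (spectralElt p α η x).coeff n = (spectralElt p α η x').coeff n
  rw [coeff_spectralElt, coeff_spectralElt]
  congr 1
  exact Finset.sum_congr rfl fun j hj => by rw [h j (Finset.mem_range.1 hj)]

variable [IsGalois K E] [CharZero E]

theorem spectral_smul_pow (D : IsRadicalDatum p α a ζ σ η) (x : ℕ → K) {k : ℕ} (hk : k < p) :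
    D.spectral x • α ^ k = x k • α ^ k := by
  have := Fintype.ofFinite (Subgroup.zpowers η)
  have hp0 : (p : E) ≠ 0 := by exact_mod_cast D.prime.ne_zero
  refine cosetEval_injective (K := K) (E := E) (funext fun y => ?_)
  rw [smul_eq_act, cosetEval_act, D.permRep_cosetEval_pow, cosetEval_smul_base, Pi.smul_apply,
    cosetEval_pow, smul_eq_mul]
  congr 1
  calc ∑ n : Subgroup.zpowers η, (spectralElt p α η x).coeff n * (rootFactor α n.1)⁻¹ ^ k
      = (p : E)⁻¹ * ∑ j ∈ Finset.range p, algebraMap K E (x j) *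
          ∑ n : Subgroup.zpowers η, rootFactor α n.1 ^ j * (rootFactor α n.1)⁻¹ ^ k := by
        simp only [coeff_spectralElt, Finset.mul_sum, Finset.sum_mul]
        rw [Finset.sum_comm]
        refine Finset.sum_congr rfl fun j _ => Finset.sum_congr rfl fun n _ => by ring
    _ = (p : E)⁻¹ * ∑ j ∈ Finset.range p, algebraMap K E (x j) * if j = k then (p : E) else 0 := by
        congr 1
        refine Finset.sum_congr rfl fun j hj => ?_
        rw [D.sum_rootFactor_pow (Finset.mem_range.1 hj) hk]
    _ = algebraMap K E (x k) := by
        simp only [mul_ite, mul_zero, Finset.sum_ite_eq', Finset.mem_range, hk, if_true]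
        field_simp

theorem spectral_smul_sum (D : IsRadicalDatum p α a ζ σ η) (x q : ℕ → K) :
    D.spectral x • (∑ j ∈ Finset.range p, q j • α ^ j) =
      ∑ j ∈ Finset.range p, (x j * q j) • α ^ j := by
  rw [Finset.smul_sum]
  refine Finset.sum_congr rfl fun j hj => ?_
  rw [smul_comm, D.spectral_smul_pow x (Finset.mem_range.1 hj), smul_smul, mul_comm]

theorem exists_eq_spectral (D : IsRadicalDatum p α a ζ σ η)
    (h : hopfAlg (Subgroup.zpowers η)) : ∃ x : ℕ → K, h = D.spectral x := by
  classical
  have := Fintype.ofFinite (Subgroup.zpowers η)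
  have hp0 : (p : E) ≠ 0 := by exact_mod_cast D.prime.ne_zero
  have hK : ∀ k : ℕ, ∃ x : K, algebraMap K E x =
      ∑ n : Subgroup.zpowers η, h.1.coeff n * (rootFactor α n.1)⁻¹ ^ k := by
    intro k
    set χ := ∑ n : Subgroup.zpowers η, h.1.coeff n * (rootFactor α n.1)⁻¹ ^ k
    have h1 : ∀ y, cosetEval (act h (α ^ k)) y = χ * cosetEval α y ^ k := fun y => by
      rw [cosetEval_act, D.permRep_cosetEval_pow]
    have h2 : χ ∈ (⊥ : IntermediateField K E) := by
      rw [IsGalois.mem_bot_iff_fixed]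
      intro g
      have h3 := h1 (QuotientGroup.mk g)
      have h4 := h1 (QuotientGroup.mk 1)
      rw [cosetEval_mk, cosetEval_mk, AlgEquiv.one_apply, AlgEquiv.one_apply] at h4
      rw [cosetEval_mk, h4, map_mul, map_pow, cosetEval_mk] at h3
      refine mul_right_cancel₀ (pow_ne_zero k ?_) h3
      simpa using D.ne_zero
    exact IntermediateField.mem_bot.1 h2
  choose x hx using hK
  refine ⟨x, Subtype.ext ?_⟩
  ext n
  change h.1.coeff n = (spectralElt p α η x).coeff n
  rw [coeff_spectralElt]
  simp only [hx, Finset.sum_mul]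
  rw [Finset.sum_comm]
  have : ∀ m : Subgroup.zpowers η, ∑ j ∈ Finset.range p,
      h.1.coeff m * (rootFactor α m.1)⁻¹ ^ j * rootFactor α n.1 ^ j =
        h.1.coeff m * if m = n then (p : E) else 0 := by
    intro m
    have h5 := D.sum_range_rootFactor_div m.2 n.2
    simp only [← Subtype.ext_iff] at h5
    rw [← h5, Finset.mul_sum]
    refine Finset.sum_congr rfl fun j _ => by ring
  simp only [this, mul_ite, mul_zero, Finset.sum_ite_eq', Finset.mem_univ, if_true]
  field_simp

theorem spectral_eq_of_smul (D : IsRadicalDatum p α a ζ σ η) {x x' : ℕ → K}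
    (h : ∀ j < p, D.spectral x • α ^ j = D.spectral x' • α ^ j) : D.spectral x = D.spectral x' := by
  refine D.spectral_congr fun j hj => ?_
  have := h j hj
  rw [D.spectral_smul_pow _ hj, D.spectral_smul_pow _ hj] at this
  exact smul_left_injective K (pow_ne_zero j D.ne_zero) this

theorem eq_of_smul (D : IsRadicalDatum p α a ζ σ η) {h h' : hopfAlg (Subgroup.zpowers η)}
    (hh : ∀ j < p, h • α ^ j = h' • α ^ j) : h = h' := by
  obtain ⟨x, rfl⟩ := D.exists_eq_spectral h
  obtain ⟨x', rfl⟩ := D.exists_eq_spectral h'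
  exact D.spectral_eq_of_smul hh

theorem sum_pow_inj (D : IsRadicalDatum p α a ζ σ η) {q q' : ℕ → K}
    (h : ∑ j ∈ Finset.range p, q j • α ^ j = ∑ j ∈ Finset.range p, q' j • α ^ j) {k : ℕ}
    (hk : k < p) : q k = q' k := by
  classical
  have h1 := congrArg (fun z => D.spectral (fun j => if j = k then 1 else 0) • z) h
  simp only [D.spectral_smul_sum, ite_mul, one_mul, zero_mul, ite_smul, zero_smul,
    Finset.sum_ite_eq', Finset.mem_range, hk, if_true] at h1
  exact smul_left_injective K (pow_ne_zero k D.ne_zero) h1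

theorem smul_sum_pow_injective (D : IsRadicalDatum p α a ζ σ η)
    {q : ℕ → K} (hq : ∀ j < p, q j ≠ 0) :
    Function.Injective fun h : hopfAlg (Subgroup.zpowers η) =>
      h • ∑ j ∈ Finset.range p, q j • α ^ j := by
  intro h h' hh
  obtain ⟨x, rfl⟩ := D.exists_eq_spectral h
  obtain ⟨x', rfl⟩ := D.exists_eq_spectral h'
  simp only [D.spectral_smul_sum] at hh
  exact D.spectral_congr fun j hj => mul_right_cancel₀ (hq j hj) (D.sum_pow_inj hh hj)

theorem spectral_mul (D : IsRadicalDatum p α a ζ σ η)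
    (x x' : ℕ → K) : D.spectral x * D.spectral x' = D.spectral (x * x') :=
  D.eq_of_smul fun j hj => by
    rw [mul_smul, D.spectral_smul_pow _ hj, smul_comm, D.spectral_smul_pow _ hj,
      D.spectral_smul_pow _ hj, smul_smul, Pi.mul_apply, mul_comm]

end IsRadicalDatum

end Spectral

end Kummer

section Integrality

theorem valuation_le_one_of_isIntegral {E : Type*} [Field E] [NumberField E] {x : E}
    (hx : IsIntegral ℤ x) (v : HeightOneSpectrum (𝓞 E)) : v.valuation E x ≤ 1 :=
  v.valuation_le_one (⟨x, hx⟩ : 𝓞 E)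

theorem isIntegral_of_valuation_le_one {E : Type*} [Field E] [NumberField E] {x : E}
    (hx : ∀ v : HeightOneSpectrum (𝓞 E), v.valuation E x ≤ 1) : IsIntegral ℤ x := by
  obtain ⟨y, rfl⟩ := HeightOneSpectrum.mem_integers_of_valuation_le_one E x hx
  exact y.isIntegral_coe

/-- If `x` and `r` are congruent modulo `p`, then `(1 / p) ∑ c j x ^ j` and `(1 / p) ∑ c j r ^ j`
differ by an integral element. -/
theorem valuation_div_sum_pow_sub_le_one {F Γ₀ : Type*} [Field F]
    [LinearOrderedCommGroupWithZero Γ₀] (v : Valuation F Γ₀) {p : ℕ} (hvp : v p ≠ 0) {x r : F}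
    (hx : v x ≤ 1) (hr : v r ≤ 1) (hxr : v (x - r) ≤ v p) {c : ℕ → F} (hc : ∀ j, v (c j) ≤ 1) :
    v ((p : F)⁻¹ * ∑ j ∈ Finset.range p, c j * x ^ j -
      (p : F)⁻¹ * ∑ j ∈ Finset.range p, c j * r ^ j) ≤ 1 := by
  rw [← mul_sub, ← Finset.sum_sub_distrib, Finset.mul_sum]
  refine v.map_sum_le fun j _ => ?_
  rw [← mul_sub, ← (Commute.all x r).mul_geom_sum₂, map_mul, map_mul, map_mul, map_inv₀]
  have h1 : v (∑ i ∈ Finset.range j, x ^ i * r ^ (j - 1 - i)) ≤ 1 := by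
    refine v.map_sum_le fun i _ => ?_
    rw [map_mul, map_pow, map_pow]
    exact mul_le_one' (pow_le_one' hx _) (pow_le_one' hr _)
  have h2 : (v p)⁻¹ * v (x - r) ≤ 1 := by
    rw [inv_mul_le_iff₀ (zero_lt_iff.2 hvp), mul_one]
    exact hxr
  calc _ = v (c j) * ((v p)⁻¹ * v (x - r)) * v (∑ i ∈ Finset.range j, x ^ i * r ^ (j - 1 - i)) := by
        rw [← mul_assoc, ← mul_assoc, mul_comm (v p)⁻¹, mul_assoc (v (c j))]
    _ ≤ 1 := mul_le_one' (mul_le_one' (hc j) h2) h1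

theorem valuation_natCast_ne_zero {E : Type*} [Field E] [NumberField E] {p : ℕ} (hp : p ≠ 0)
    (v : HeightOneSpectrum (𝓞 E)) : v.valuation E (p : E) ≠ 0 := by
  rw [Valuation.ne_zero_iff]
  exact_mod_cast hp

variable {K L E : Type*} [Field K] [Field L] [Field E] [Algebra K L] [Algebra L E]
  [Algebra K E] [IsScalarTower K L E]

theorem isIntegral_cosetEval {x : L} (hx : IsIntegral ℤ x) (y : CosetSpace K L E) :
    IsIntegral ℤ (cosetEval x y) := by
  induction y using QuotientGroup.induction_on with
  | H g => exact (hx.algebraMap (B := E)).map g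

variable [NumberField K] [NumberField E]

theorem mem_integralInvariants_iff {N : Subgroup (Equiv.Perm (CosetSpace K L E))}
    {h : hopfAlg N} : h ∈ integralInvariants N ↔ ∀ n, IsIntegral ℤ (h.1.coeff n) := by
  have := Fintype.ofFinite N
  constructor
  · rintro ⟨c, hc⟩ n
    have : h.1.coeff n = algebraMap (𝓞 E) E (c.coeff n) := by
      have h1 := congrArg (fun z : MonoidAlgebra E N => z.coeff n) hc
      exact h1.symm.trans (MonoidAlgebra.coeff_mapAlgHom _ _ _)
    rw [this]
    exact (c.coeff n).isIntegral_coe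
  · intro hint
    refine ⟨MonoidAlgebra.ofCoeff (Finsupp.equivFunOnFinite.symm fun n => ⟨_, hint n⟩), ?_⟩
    ext n
    exact MonoidAlgebra.coeff_mapAlgHom _ _ _

theorem IsRadicalDatum.exists_root_valuation_sub_le {p : ℕ} {α : 𝓞 L} {a : 𝓞 K} {ζ : E}
    {σ : E ≃ₐ[K] E} {η : Equiv.Perm (CosetSpace K L E)}
    (D : IsRadicalDatum p (algebraMap (𝓞 L) L α) (algebraMap (𝓞 K) K a) ζ σ η)
    (ha : (p : 𝓞 K) ^ 2 ∣ a - 1)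
    (v : HeightOneSpectrum (𝓞 E)) :
    ∃ r : E, r ^ p = 1 ∧
      v.valuation E (algebraMap L E (algebraMap (𝓞 L) L α) - r) ≤ v.valuation E (p : E) := by
  refine exists_root_of_unity_valuation_sub_le _ D.prime.pos D.prim
    (valuation_natCast_ne_zero D.prime.ne_zero v) ?_
  obtain ⟨t, ht⟩ := ha
  have h1 : algebraMap L E (algebraMap (𝓞 L) L α) ^ p - 1 =
      (p : E) ^ 2 * algebraMap K E (algebraMap (𝓞 K) K t) := by
    have h2 := congrArg (fun z => algebraMap K E (algebraMap (𝓞 K) K z)) ht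
    simp only [map_sub, map_one, map_mul, map_pow, map_natCast] at h2
    rw [← map_pow, D.pow_eq, ← IsScalarTower.algebraMap_apply K L E, h2]
  rw [h1, map_mul, map_pow]
  refine mul_le_of_le_one_right zero_le (valuation_le_one_of_isIntegral ?_ v)
  exact t.isIntegral_coe.algebraMap

theorem IsRadicalDatum.isIntegral_div_sum_pow {p : ℕ} {α : 𝓞 L} {a : 𝓞 K} {ζ : E}
    {σ : E ≃ₐ[K] E} {η : Equiv.Perm (CosetSpace K L E)}
   
    (D : IsRadicalDatum p (algebraMap (𝓞 L) L α) (algebraMap (𝓞 K) K a) ζ σ η)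
    (ha : (p : 𝓞 K) ^ 2 ∣ a - 1) :
    IsIntegral ℤ ((p : L)⁻¹ * ∑ j ∈ Finset.range p, algebraMap (𝓞 L) L α ^ j) := by
  have hp0 : (p : E) ≠ 0 := by exact_mod_cast D.prime.ne_zero
  rw [← isIntegral_algebraMap_iff (FaithfulSMul.algebraMap_injective L E)]
  refine isIntegral_of_valuation_le_one fun v => ?_
  obtain ⟨r, hr, hαr⟩ := D.exists_root_valuation_sub_le ha v
  have hrint : IsIntegral ℤ r := IsIntegral.of_pow D.prime.pos (hr ▸ isIntegral_one)
  have hαint : IsIntegral ℤ (algebraMap L E (algebraMap (𝓞 L) L α)) := α.isIntegral_coe.algebraMap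
  have h1 := valuation_div_sum_pow_sub_le_one (v.valuation E)
    (valuation_natCast_ne_zero D.prime.ne_zero v)
    (valuation_le_one_of_isIntegral hαint v) (valuation_le_one_of_isIntegral hrint v) hαr
    (c := fun _ => 1) (fun _ => by simp)
  simp only [one_mul] at h1
  have h2 : v.valuation E ((p : E)⁻¹ * ∑ j ∈ Finset.range p, r ^ j) ≤ 1 := by
    by_cases hr1 : r = 1
    · simp [hr1, hp0]
    · simp [geom_sum_of_pow_eq_one hr hr1]
  rw [map_mul, map_inv₀, map_natCast, map_sum]
  simp only [map_pow]
  have h3 := (v.valuation E).map_add_le h1 h2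
  rwa [sub_add_cancel] at h3

variable [IsGalois K E]

theorem mem_associatedOrder_iff {N : Subgroup (Equiv.Perm (CosetSpace K L E))} {h : hopfAlg N} :
    h ∈ associatedOrder N ↔ ∀ x : L, IsIntegral ℤ x → IsIntegral ℤ (h • x) :=
  ⟨fun hh x hx => hh ⟨x, hx⟩, fun hh x => hh x x.isIntegral_coe⟩

variable [NumberField L]

theorem integralInvariants_le_associatedOrder (N : Subgroup (Equiv.Perm (CosetSpace K L E))) :
    integralInvariants N ≤ associatedOrder N := by
  intro h hh
  rw [mem_integralInvariants_iff] at hh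
  rw [mem_associatedOrder_iff]
  intro x hx
  rw [← isIntegral_algebraMap_iff (FaithfulSMul.algebraMap_injective L E), smul_eq_act,
    algebraMap_act]
  exact IsIntegral.sum _ fun n _ => (hh n).mul (isIntegral_cosetEval hx _)

namespace IsRadicalDatum

variable {p : ℕ} {α : 𝓞 L} {a : 𝓞 K} {ζ : E} {σ : E ≃ₐ[K] E}
  {η : Equiv.Perm (CosetSpace K L E)}

theorem spectral_mem_integralInvariants
    (D : IsRadicalDatum p (algebraMap (𝓞 L) L α) (algebraMap (𝓞 K) K a) ζ σ η)
    (ha : (p : 𝓞 K) ^ 2 ∣ a - 1) {x : ℕ → K}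
    (hx : ∀ j, IsIntegral ℤ (x j))
    (hz : IsIntegral ℤ (D.spectral x •
      ((p : L)⁻¹ * ∑ j ∈ Finset.range p, algebraMap (𝓞 L) L α ^ j))) :
    D.spectral x ∈ integralInvariants (Subgroup.zpowers η) := by
  rw [mem_integralInvariants_iff]
  intro n
  change IsIntegral ℤ ((spectralElt p _ η x).coeff n)
  rw [coeff_spectralElt]
  refine isIntegral_of_valuation_le_one fun v => ?_
  obtain ⟨r, hr, hαr⟩ := D.exists_root_valuation_sub_le ha v
  obtain ⟨hψ, -⟩ := D.rootFactor_spec n.2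
  set β := algebraMap L E (algebraMap (𝓞 L) L α) with hβ
  set ψ := rootFactor (algebraMap (𝓞 L) L α) n.1
  have hr0 : r ≠ 0 := by
    rintro rfl
    rw [zero_pow D.prime.ne_zero] at hr
    exact zero_ne_one hr
  have hρ : (ψ / r) ^ p = 1 := by rw [div_pow, hψ, hr, div_one]
  obtain ⟨k, hk⟩ := D.exists_zpow_of_pow_eq_one hρ
  have hψint : IsIntegral ℤ ψ := IsIntegral.of_pow D.prime.pos (hψ ▸ isIntegral_one)
  have hρint : IsIntegral ℤ (ψ / r) := IsIntegral.of_pow D.prime.pos (hρ ▸ isIntegral_one)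
  have hβint : IsIntegral ℤ β := α.isIntegral_coe.algebraMap
  have hxint : ∀ j, v.valuation E (algebraMap K E (x j)) ≤ 1 := fun j =>
    valuation_le_one_of_isIntegral (hx j).algebraMap v
  have hclose : v.valuation E (ψ / r * β - ψ) ≤ v.valuation E (p : E) := by
    have : ψ / r * β - ψ = ψ / r * (β - r) := by field_simp
    rw [this, map_mul]
    exact (mul_le_of_le_one_left zero_le (valuation_le_one_of_isIntegral hρint v)).trans hαr
  have h1 := valuation_div_sum_pow_sub_le_one (v.valuation E)
    (valuation_natCast_ne_zero D.prime.ne_zero v)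
    (valuation_le_one_of_isIntegral (hρint.mul hβint) v)
    (valuation_le_one_of_isIntegral hψint v) hclose hxint
  have h2 : v.valuation E ((p : E)⁻¹ *
      ∑ j ∈ Finset.range p, algebraMap K E (x j) * (ψ / r * β) ^ j) ≤ 1 := by
    refine valuation_le_one_of_isIntegral ?_ v
    have h3 := (hz.algebraMap (B := E)).map (σ ^ k)
    convert h3 using 1
    have h4 : (p : L)⁻¹ * ∑ j ∈ Finset.range p, algebraMap (𝓞 L) L α ^ j =
        ∑ j ∈ Finset.range p, (p : K)⁻¹ • algebraMap (𝓞 L) L α ^ j := by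
      rw [← Finset.smul_sum, Algebra.smul_def, map_inv₀, map_natCast]
    rw [h4, D.spectral_smul_sum x fun _ => (p : K)⁻¹, map_sum, map_sum, Finset.mul_sum]
    refine Finset.sum_congr rfl fun j _ => ?_
    rw [Algebra.smul_def, map_mul, map_pow, ← IsScalarTower.algebraMap_apply, map_mul, map_pow,
      D.zpow_map_eq, AlgEquiv.commutes, ← hk, map_mul, map_inv₀, map_natCast]
    ring
  have h5 := (v.valuation E).map_sub_le h2 h1
  rwa [sub_sub_cancel] at h5

theorem isIntegral_of_spectral_mem
    (D : IsRadicalDatum p (algebraMap (𝓞 L) L α) (algebraMap (𝓞 K) K a) ζ σ η) {x : ℕ → K}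
    (hx : D.spectral x ∈ associatedOrder (Subgroup.zpowers η)) {j : ℕ} (hj : j < p) :
    IsIntegral ℤ (x j) := by
  rw [mem_associatedOrder_iff] at hx
  let M : Submodule ℤ L := (integralClosure ℤ L).toSubmodule ⊓
    (Submodule.span K {algebraMap (𝓞 L) L α ^ j}).restrictScalars ℤ
  have hfg : M.FG := by
    have : IsNoetherian ℤ (integralClosure ℤ L).toSubmodule :=
      inferInstanceAs (IsNoetherian ℤ (𝓞 L))
    exact isNoetherian_submodule.1 this _ inf_le_left
  refine isIntegral_of_smul_mem_submodule M ?_ hfg (x j) ?_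
  · intro hbot
    have hmem : algebraMap (𝓞 L) L α ^ j ∈ M :=
      ⟨α.isIntegral_coe.pow j, Submodule.mem_span_singleton_self _⟩
    rw [hbot, Submodule.mem_bot] at hmem
    exact pow_ne_zero j D.ne_zero hmem
  · rintro z ⟨hz, hz'⟩
    obtain ⟨c, rfl⟩ := Submodule.mem_span_singleton.1 hz'
    refine ⟨?_, Submodule.smul_mem (Submodule.span K {algebraMap (𝓞 L) L α ^ j}) (x j) hz'⟩
    have h1 := hx _ hz
    rwa [smul_comm, D.spectral_smul_pow x hj, smul_comm] at h1

theorem associatedOrder_eq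
    (D : IsRadicalDatum p (algebraMap (𝓞 L) L α) (algebraMap (𝓞 K) K a) ζ σ η)
    (ha : (p : 𝓞 K) ^ 2 ∣ a - 1) :
    associatedOrder (Subgroup.zpowers η) = integralInvariants (Subgroup.zpowers η) := by
  refine le_antisymm (fun h hh => ?_) (integralInvariants_le_associatedOrder _)
  obtain ⟨x, rfl⟩ := D.exists_eq_spectral h
  have hx : D.spectral x = D.spectral fun j => if j < p then x j else 0 :=
    D.spectral_congr fun j hj => by rw [if_pos hj]
  have hz := mem_associatedOrder_iff.1 hh _ (D.isIntegral_div_sum_pow ha)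
  have hint : ∀ j, IsIntegral ℤ (if j < p then x j else 0) := by
    intro j
    split_ifs with hj
    · exact D.isIntegral_of_spectral_mem hh hj
    · exact isIntegral_zero
  rw [hx] at hz ⊢
  exact D.spectral_mem_integralInvariants ha hint hz

end IsRadicalDatum

end Integrality

section LocalFreeness

theorem IsFreeGenerator.units_smul {A M : Type*} [Ring A] [AddCommGroup M] [Module A M] {y : M}
    (hy : IsFreeGenerator A y) {u : A} (hu : IsUnit u) : IsFreeGenerator A (u • y) := by
  have h := hy.comp hu.unit.mulRight.bijective
  have : (fun a : A => a • u • y) = (fun a : A => a • y) ∘ hu.unit.mulRight := by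
    funext a
    simp [mul_smul]
  rwa [IsFreeGenerator, this]

theorem exists_common_denominator {K : Type*} [Field K] [NumberField K]
    (v : HeightOneSpectrum (𝓞 K)) (s : Finset ℕ) {x : ℕ → K}
    (hx : ∀ j ∈ s, v.valuation K (x j) ≤ 1) :
    ∃ t : 𝓞 K, t ∉ v.asIdeal ∧ ∀ j ∈ s, IsIntegral ℤ (algebraMap (𝓞 K) K t * x j) := by
  classical
  have h1 : ∀ j, ∃ d : 𝓞 K, d ∉ v.asIdeal ∧
      (j ∈ s → IsIntegral ℤ (algebraMap (𝓞 K) K d * x j)) := by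
    intro j
    by_cases hj : j ∈ s
    · obtain ⟨n, d, hd⟩ := v.exists_primeCompl_mul_eq_of_integer (x j) (hx j hj)
      refine ⟨d, d.2, fun _ => ?_⟩
      rw [mul_comm, hd]
      exact n.isIntegral_coe
    · exact ⟨1, v.isPrime.one_notMem, fun h => absurd h hj⟩
  choose d hd hd' using h1
  refine ⟨∏ j ∈ s, d j, ?_, fun j hj => ?_⟩
  · intro hmem
    obtain ⟨j, -, hj⟩ := v.isPrime.prod_mem_iff.1 hmem
    exact hd j hj
  · rw [← Finset.prod_erase_mul _ _ hj, map_mul, mul_assoc]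
    exact (NumberField.RingOfIntegers.isIntegral_coe _).mul (hd' j hj)

theorem isUnit_algebraMap_of_notMem {K : Type*} [Field K] [NumberField K]
    {v : HeightOneSpectrum (𝓞 K)} {t : 𝓞 K} (ht : t ∉ v.asIdeal) :
    IsUnit (algebraMap (𝓞 K) (v.adicCompletionIntegers K) t) := by
  rw [HeightOneSpectrum.adicCompletionIntegers.isUnit_iff_valued_eq_one]
  exact (HeightOneSpectrum.valuedAdicCompletion_eq_valuation v t).trans
    (v.valuation_eq_one_iff_notMem.2 ht)

variable {K L E : Type*} [Field K] [Field L] [Field E] [NumberField K] [NumberField L]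
  [NumberField E] [Algebra K L] [Algebra L E] [Algebra K E] [IsScalarTower K L E] [IsGalois K E]

theorem isFreeGenerator_one_tmul (N : Subgroup (Equiv.Perm (CosetSpace K L E)))
    (v : HeightOneSpectrum (𝓞 K)) (y : 𝓞 L)
    (hinj : Function.Injective fun h : associatedOrder N => h • y)
    (hsurj : ∀ z : 𝓞 L, ∃ t : 𝓞 K, t ∉ v.asIdeal ∧ ∃ h : associatedOrder N, h • y = t • z) :
    IsFreeGenerator (LocalOrder N v) (1 ⊗ₜ[𝓞 K] y : LocalIntegers L v) := by
  let f : associatedOrder N →ₗ[𝓞 K] 𝓞 L :=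
    (LinearMap.toSpanSingleton (associatedOrder N) (𝓞 L) y).restrictScalars (𝓞 K)
  have hf : ∀ h, f h = h • y := fun h => rfl
  have heq : (fun a : LocalOrder N v => a • (1 ⊗ₜ[𝓞 K] y : LocalIntegers L v)) =
      f.lTensor (v.adicCompletionIntegers K) := by
    funext b
    induction b using TensorProduct.induction_on with
    | zero =>
      rw [map_zero]
      exact zero_smul (LocalOrder N v) (1 ⊗ₜ[𝓞 K] y : LocalIntegers L v)
    | tmul c h => rw [tmul_smul_tmul, LinearMap.lTensor_tmul, hf, mul_one]
    | add b c hb hc => rw [add_smul, hb, hc, map_add]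
  rw [IsFreeGenerator, heq]
  refine ⟨Module.Flat.lTensor_preserves_injective_linearMap f hinj, fun b => ?_⟩
  induction b using TensorProduct.induction_on with
  | zero => exact ⟨0, map_zero _⟩
  | add b c hb hc =>
    obtain ⟨b', rfl⟩ := hb
    obtain ⟨c', rfl⟩ := hc
    exact ⟨b' + c', map_add _ _ _⟩
  | tmul c z =>
    obtain ⟨t, ht, h, hh⟩ := hsurj z
    obtain ⟨u, hu⟩ := isUnit_algebraMap_of_notMem ht
    refine ⟨(c * ↑u⁻¹) ⊗ₜ h, ?_⟩
    rw [LinearMap.lTensor_tmul, hf, hh, ← TensorProduct.smul_tmul, Algebra.smul_def, ← hu,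
      mul_left_comm, Units.mul_inv, mul_one]

theorem toLocalField_tmul (v : HeightOneSpectrum (𝓞 K)) (c : v.adicCompletionIntegers K)
    (x : 𝓞 L) :
    toLocalField L v (c ⊗ₜ x) = (c : v.adicCompletion K) ⊗ₜ[K] algebraMap (𝓞 L) L x := by
  rw [toLocalField, Algebra.TensorProduct.productMap_apply_tmul]
  change ((c : v.adicCompletion K) ⊗ₜ[K] (1 : L)) *
    ((1 : v.adicCompletion K) ⊗ₜ[K] algebraMap (𝓞 L) L x) = _
  rw [Algebra.TensorProduct.tmul_mul_tmul, mul_one, one_mul]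

theorem isIntegral_algebraMap_field_iff {x : K} :
    IsIntegral ℤ (algebraMap K L x) ↔ IsIntegral ℤ x :=
  isIntegral_algebraMap_iff (FaithfulSMul.algebraMap_injective K L)

namespace IsRadicalDatum

variable {p : ℕ} {α : 𝓞 L} {a : 𝓞 K} {ζ : E} {σ : E ≃ₐ[K] E}
  {η : Equiv.Perm (CosetSpace K L E)}

theorem spectral_mem_associatedOrder
    (D : IsRadicalDatum p (algebraMap (𝓞 L) L α) (algebraMap (𝓞 K) K a) ζ σ η) {x : ℕ → K}
    (hx : ∀ j < p, IsIntegral ℤ ((p : K)⁻¹ * x j)) :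
    D.spectral x ∈ associatedOrder (Subgroup.zpowers η) := by
  refine integralInvariants_le_associatedOrder _ (mem_integralInvariants_iff.2 fun n => ?_)
  change IsIntegral ℤ ((spectralElt p _ η x).coeff n)
  rw [coeff_spectralElt, Finset.mul_sum]
  refine IsIntegral.sum _ fun j hj => ?_
  have h1 : (p : E)⁻¹ * (algebraMap K E (x j) * rootFactor (algebraMap (𝓞 L) L α) n.1 ^ j) =
      algebraMap K E ((p : K)⁻¹ * x j) * rootFactor (algebraMap (𝓞 L) L α) n.1 ^ j := by
    rw [map_mul, map_inv₀, map_natCast, mul_assoc]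
  rw [h1]
  refine (hx j (Finset.mem_range.1 hj)).algebraMap.mul (IsIntegral.pow ?_ j)
  exact IsIntegral.of_pow D.prime.pos ((D.rootFactor_spec n.2).1 ▸ isIntegral_one)

/-- The element of the associated order that acts as `p` on `α ^ k` and annihilates the other
powers of `α`. -/
def scaledProj (D : IsRadicalDatum p (algebraMap (𝓞 L) L α) (algebraMap (𝓞 K) K a) ζ σ η)
    (k : ℕ) : associatedOrder (Subgroup.zpowers η) :=
  ⟨D.spectral (Pi.single k (p : K)), D.spectral_mem_associatedOrder fun j _ => by
    rcases eq_or_ne j k with rfl | hjk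
    · rw [Pi.single_eq_same, inv_mul_cancel₀ D.natCast_ne_zero]
      exact isIntegral_one
    · rw [Pi.single_eq_of_ne hjk, mul_zero]
      exact isIntegral_zero⟩

theorem scaledProj_smul_sum
    (D : IsRadicalDatum p (algebraMap (𝓞 L) L α) (algebraMap (𝓞 K) K a) ζ σ η)
    (q : ℕ → K) {k : ℕ} (hk : k < p) :
    (D.scaledProj k : hopfAlg (Subgroup.zpowers η)) •
      (∑ j ∈ Finset.range p, q j • algebraMap (𝓞 L) L α ^ j) =
        ((p : K) * q k) • algebraMap (𝓞 L) L α ^ k := by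
  refine (D.spectral_smul_sum _ q).trans ?_
  rw [Finset.sum_eq_single k]
  · rw [Pi.single_eq_same]
  · intro j _ hjk
    rw [Pi.single_eq_of_ne hjk, zero_mul, zero_smul]
  · intro h
    exact absurd (Finset.mem_range.2 hk) h

theorem scaledProj_mul (D : IsRadicalDatum p (algebraMap (𝓞 L) L α) (algebraMap (𝓞 K) K a) ζ σ η)
    (i j : ℕ) :
    D.scaledProj i * D.scaledProj j = if i = j then p • D.scaledProj i else 0 := by
  refine Subtype.ext ?_
  change D.spectral _ * D.spectral _ = _
  rw [D.spectral_mul]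
  split_ifs with h
  · subst h
    change _ = p • D.spectral _
    refine D.eq_of_smul fun k hk => ?_
    rw [smul_assoc, D.spectral_smul_pow _ hk, D.spectral_smul_pow _ hk, Pi.mul_apply,
      ← Nat.cast_smul_eq_nsmul K, smul_smul]
    rcases eq_or_ne k i with rfl | hki
    · simp
    · simp [Pi.single_eq_of_ne hki]
  · change _ = (0 : hopfAlg (Subgroup.zpowers η))
    refine D.eq_of_smul fun k hk => ?_
    rw [D.spectral_smul_pow _ hk, zero_smul, Pi.mul_apply]
    rcases eq_or_ne k i with rfl | hki
    · simp [Pi.single_eq_of_ne h]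
    · simp [Pi.single_eq_of_ne hki]

theorem sum_scaledProj (D : IsRadicalDatum p (algebraMap (𝓞 L) L α) (algebraMap (𝓞 K) K a) ζ σ η) :
    ∑ j ∈ Finset.range p, D.scaledProj j = p • 1 := by
  refine Subtype.ext ?_
  rw [AddSubmonoidClass.coe_finsetSum]
  change ∑ j ∈ Finset.range p, D.spectral (Pi.single j (p : K)) =
    p • (1 : hopfAlg (Subgroup.zpowers η))
  refine D.eq_of_smul fun k hk => ?_
  rw [smul_assoc, one_smul, ← Nat.cast_smul_eq_nsmul K, Finset.sum_smul, Finset.sum_eq_single k]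
  · rw [D.spectral_smul_pow _ hk, Pi.single_eq_same]
  · intro j _ hjk
    rw [D.spectral_smul_pow _ hk, Pi.single_eq_of_ne hjk.symm, zero_smul]
  · intro h
    exact absurd (Finset.mem_range.2 hk) h

theorem isIntegral_natCast_mul_smul_pow
    (D : IsRadicalDatum p (algebraMap (𝓞 L) L α) (algebraMap (𝓞 K) K a) ζ σ η) {q : ℕ → K}
    (hz : IsIntegral ℤ (∑ j ∈ Finset.range p, q j • algebraMap (𝓞 L) L α ^ j)) {k : ℕ}
    (hk : k < p) : IsIntegral ℤ (((p : K) * q k) • algebraMap (𝓞 L) L α ^ k) := by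
  rw [← D.scaledProj_smul_sum q hk]
  exact mem_associatedOrder_iff.1 (D.scaledProj k).2 _ hz

theorem isFreeGenerator_of_mem
    (D : IsRadicalDatum p (algebraMap (𝓞 L) L α) (algebraMap (𝓞 K) K a) ζ σ η)
    (ha : (p : 𝓞 K) ^ 2 ∣ a - 1) (v : HeightOneSpectrum (𝓞 K))
    (hv : (p : 𝓞 K) ∈ v.asIdeal) {y : 𝓞 L} (hy' : algebraMap (𝓞 L) L y =
      (p : L)⁻¹ * ∑ j ∈ Finset.range p, algebraMap (𝓞 L) L α ^ j) :
    IsFreeGenerator (LocalOrder (Subgroup.zpowers η) v) (1 ⊗ₜ[𝓞 K] y : LocalIntegers L v) := by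
  have hp0 := D.natCast_ne_zero
  have hy : (p : L)⁻¹ * ∑ j ∈ Finset.range p, algebraMap (𝓞 L) L α ^ j =
      ∑ j ∈ Finset.range p, (p : K)⁻¹ • algebraMap (𝓞 L) L α ^ j := by
    rw [← Finset.smul_sum, Algebra.smul_def, map_inv₀, map_natCast]
  refine isFreeGenerator_one_tmul _ v _ (fun h h' hh => ?_) fun z => ?_
  · have h1 : h.1 • algebraMap (𝓞 L) L y = h'.1 • algebraMap (𝓞 L) L y :=
      congrArg Subtype.val hh
    rw [hy', hy] at h1
    exact Subtype.ext (D.smul_sum_pow_injective (fun _ _ => inv_ne_zero hp0) h1)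
  · refine ⟨a, ?_, ?_⟩
    · intro hav
      have h1 : a - 1 ∈ v.asIdeal :=
        Ideal.mem_of_dvd _ ((dvd_pow_self _ two_ne_zero).trans ha) hv
      exact v.isPrime.one_notMem (by simpa using sub_mem hav h1)
    obtain ⟨q, hq⟩ := exists_eq_sum_pow D.prime.ne_zero D.pow_eq D.adjoin_eq (algebraMap (𝓞 L) L z)
    have hzint : IsIntegral ℤ (∑ j ∈ Finset.range p, q j • algebraMap (𝓞 L) L α ^ j) := by
      rw [← hq]
      exact z.isIntegral_coe
    let x : ℕ → K := fun j => if j < p then algebraMap (𝓞 K) K a * (p * q j) else 0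
    have hx : ∀ j, IsIntegral ℤ (x j) := by
      intro j
      by_cases hj : j < p
      · have h1 : x j = algebraMap (𝓞 K) K a * (p * q j) := if_pos hj
        rw [h1, ← isIntegral_algebraMap_field_iff (L := L), map_mul, ← D.pow_eq]
        have h2 : algebraMap (𝓞 L) L α ^ p * algebraMap K L (p * q j) =
            algebraMap (𝓞 L) L α ^ (p - j) * (((p : K) * q j) • algebraMap (𝓞 L) L α ^ j) := by
          rw [Algebra.smul_def, mul_left_comm, ← pow_add, Nat.sub_add_cancel hj.le, mul_comm]
        rw [h2]
        exact (α.isIntegral_coe.pow _).mul (D.isIntegral_natCast_mul_smul_pow hzint hj)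
      · have h1 : x j = 0 := if_neg hj
        rw [h1]
        exact isIntegral_zero
    have hact : D.spectral x • ((p : L)⁻¹ * ∑ j ∈ Finset.range p, algebraMap (𝓞 L) L α ^ j) =
        algebraMap (𝓞 L) L (a • z) := by
      rw [hy, D.spectral_smul_sum x fun _ => (p : K)⁻¹, Algebra.smul_def, map_mul, hq,
        ← IsScalarTower.algebraMap_apply, IsScalarTower.algebraMap_apply (𝓞 K) K L,
        ← Algebra.smul_def, Finset.smul_sum]
      refine Finset.sum_congr rfl fun j hj => ?_
      have h1 : x j = algebraMap (𝓞 K) K a * (p * q j) := if_pos (Finset.mem_range.1 hj)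
      rw [h1, smul_smul]
      congr 1
      field_simp
    have hmem := integralInvariants_le_associatedOrder _
      (D.spectral_mem_integralInvariants ha hx (hact ▸ (a • z).isIntegral_coe))
    exact ⟨⟨_, hmem⟩, Subtype.ext ((congrArg (D.spectral x • ·) hy').trans hact)⟩

end IsRadicalDatum

end LocalFreeness

section TameLocal

theorem mul_tmul_nsmul {K : Type*} [Field K] [NumberField K] {M : Type*}
    [AddCommGroup M] [Module (𝓞 K) M] {p : ℕ} {v : HeightOneSpectrum (𝓞 K)}
    {i : v.adicCompletionIntegers K} (hi : i * p = 1) (c : v.adicCompletionIntegers K) (m : M) :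
    (c * i) ⊗ₜ[𝓞 K] (p • m) = c ⊗ₜ[𝓞 K] m := by
  rw [← Nat.cast_smul_eq_nsmul (𝓞 K), ← TensorProduct.smul_tmul, Algebra.smul_def, map_natCast,
    mul_left_comm, mul_comm (p : v.adicCompletionIntegers K), hi, mul_one]

variable {K L E : Type*} [Field K] [Field L] [Field E] [NumberField K] [NumberField L]
  [Algebra K L] [Algebra L E] [Algebra K E] [IsScalarTower K L E]

theorem rFloor_mul_le {p : ℕ} (hp : 0 < p) (v : HeightOneSpectrum (𝓞 K)) (x : K) :
    (p : ℤ) * rFloor p v x ≤ ord v x := by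
  have hp' : (0 : ℚ) < p := by exact_mod_cast hp
  have h : (rFloor p v x : ℚ) ≤ (ord v x : ℚ) / (p : ℚ) := Int.floor_le _
  rw [le_div_iff₀ hp', mul_comm] at h
  exact_mod_cast h

theorem le_rFloor {p : ℕ} (hp : 0 < p) (v : HeightOneSpectrum (𝓞 K)) (x : K) {m : ℤ}
    (hm : (p : ℤ) * m ≤ ord v x) : m ≤ rFloor p v x := by
  have hp' : (0 : ℚ) < p := by exact_mod_cast hp
  rw [rFloor, Int.le_floor, le_div_iff₀ hp', mul_comm]
  exact_mod_cast hm

theorem valuation_inv_zpow_pow_mul_le_one {p : ℕ} (hp : 0 < p) (v : HeightOneSpectrum (𝓞 K))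
    {ϖ x : K} (hϖ : v.valuation K ϖ = WithZero.exp (-1 : ℤ)) (hx : x ≠ 0) :
    v.valuation K (((ϖ ^ rFloor p v x)⁻¹) ^ p * x) ≤ 1 := by
  have hx0 : v.valuation K x ≠ 0 := (Valuation.ne_zero_iff _).2 hx
  have h := rFloor_mul_le hp v x
  rw [ord] at h
  rw [map_mul, map_pow, map_inv₀, map_zpow₀, hϖ, ← WithZero.exp_zsmul, ← WithZero.exp_neg,
    ← WithZero.exp_nsmul, ← WithZero.exp_log hx0, ← WithZero.exp_add, ← WithZero.exp_zero,
    WithZero.exp_le_exp]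
  simp only [nsmul_eq_mul, zsmul_eq_mul, Int.cast_id]
  linarith

theorem valuation_le_inv_zpow {p : ℕ} (hp : 0 < p) (v : HeightOneSpectrum (𝓞 K)) {ϖ x q : K}
    (hϖ : v.valuation K ϖ = WithZero.exp (-1 : ℤ)) (hx : x ≠ 0)
    (hq : v.valuation K (q ^ p * x) ≤ 1) :
    v.valuation K q ≤ v.valuation K (ϖ ^ rFloor p v x)⁻¹ := by
  rcases eq_or_ne q 0 with rfl | hq0
  · rw [map_zero]
    exact zero_le
  have hx0 : v.valuation K x ≠ 0 := (Valuation.ne_zero_iff _).2 hx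
  have hq0' : v.valuation K q ≠ 0 := (Valuation.ne_zero_iff _).2 hq0
  have hprod : v.valuation K q ^ p * v.valuation K x ≠ 0 := mul_ne_zero (pow_ne_zero _ hq0') hx0
  rw [map_mul, map_pow, ← WithZero.exp_zero, ← WithZero.log_le_iff_le_exp hprod,
    WithZero.log_mul (pow_ne_zero _ hq0') hx0, WithZero.log_pow, nsmul_eq_mul] at hq
  have h := le_rFloor hp v x (m := WithZero.log (v.valuation K q)) (by rw [ord]; linarith)
  rw [map_inv₀, map_zpow₀, hϖ, ← WithZero.exp_zsmul, ← WithZero.exp_neg,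
    ← WithZero.log_le_iff_le_exp hq0']
  simpa using h

namespace IsRadicalDatum

variable {p : ℕ} {α : 𝓞 L} {a : 𝓞 K} {ζ : E} {σ : E ≃ₐ[K] E}
  {η : Equiv.Perm (CosetSpace K L E)}

theorem exists_denominator_of_pow
    (D : IsRadicalDatum p (algebraMap (𝓞 L) L α) (algebraMap (𝓞 K) K a) ζ σ η)
    {v : HeightOneSpectrum (𝓞 K)} {b : ℕ → K}
    (hb : ∀ j, v.valuation K (b j ^ p * algebraMap (𝓞 K) K a ^ j) ≤ 1) :
    ∃ s : 𝓞 K, s ∉ v.asIdeal ∧ ∀ j ∈ Finset.range p,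
      IsIntegral ℤ ((algebraMap (𝓞 K) K s * b j) • algebraMap (𝓞 L) L α ^ j) := by
  obtain ⟨s, hs, hint⟩ := exists_common_denominator v (Finset.range p) fun j _ => hb j
  refine ⟨s, hs, fun j hj => IsIntegral.of_pow D.prime.pos ?_⟩
  rw [smul_pow, D.pow_pow_eq, Algebra.smul_def, ← map_mul, isIntegral_algebraMap_field_iff]
  have h1 : (algebraMap (𝓞 K) K s * b j) ^ p * algebraMap (𝓞 K) K a ^ j =
      algebraMap (𝓞 K) K s ^ (p - 1) *
        (algebraMap (𝓞 K) K s * (b j ^ p * algebraMap (𝓞 K) K a ^ j)) := by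
    rw [← mul_assoc (_ ^ (p - 1)), ← pow_succ, Nat.sub_add_cancel D.prime.one_le, mul_pow,
      mul_assoc]
  rw [h1]
  exact (s.isIntegral_coe.pow _).mul (hint j hj)

variable [NumberField E] [IsGalois K E]

/-- If the elements `β j = s b j α ^ j` of `𝓞 L` are minimal at `v`, then their sum is a
local generator at `v`. -/
theorem isFreeGenerator_of_notMem
    (D : IsRadicalDatum p (algebraMap (𝓞 L) L α) (algebraMap (𝓞 K) K a) ζ σ η)
    {v : HeightOneSpectrum (𝓞 K)} (hv : (p : 𝓞 K) ∉ v.asIdeal)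
    {s : 𝓞 K} (hs : s ∉ v.asIdeal) {b : ℕ → K} (hb : ∀ j, b j ≠ 0)
    (hmin : ∀ j, ∀ q : K, v.valuation K (q ^ p * algebraMap (𝓞 K) K a ^ j) ≤ 1 →
      v.valuation K q ≤ v.valuation K (b j)) {y : 𝓞 L}
    (hy : algebraMap (𝓞 L) L y =
      ∑ j ∈ Finset.range p, (algebraMap (𝓞 K) K s * b j) • algebraMap (𝓞 L) L α ^ j) :
    IsFreeGenerator (LocalOrder (Subgroup.zpowers η) v) (1 ⊗ₜ[𝓞 K] y : LocalIntegers L v) := by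
  have hp0 := D.natCast_ne_zero
  have hvs : v.valuation K (algebraMap (𝓞 K) K s) = 1 := v.valuation_eq_one_iff_notMem.2 hs
  have hvp : v.valuation K (p : K) = 1 := by
    simpa using (v.valuation_eq_one_iff_notMem (K := K)).2 hv
  have hs0 : algebraMap (𝓞 K) K s ≠ 0 := by
    intro h
    rw [h, map_zero] at hvs
    exact zero_ne_one hvs
  refine isFreeGenerator_one_tmul _ v _ (fun h h' hh => ?_) fun z => ?_
  · have h1 : h.1 • algebraMap (𝓞 L) L y = h'.1 • algebraMap (𝓞 L) L y :=
      congrArg Subtype.val hh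
    rw [hy] at h1
    exact Subtype.ext (D.smul_sum_pow_injective (fun j _ => mul_ne_zero hs0 (hb j)) h1)
  obtain ⟨q, hq⟩ := exists_eq_sum_pow D.prime.ne_zero D.pow_eq D.adjoin_eq (algebraMap (𝓞 L) L z)
  have hzint : IsIntegral ℤ (∑ j ∈ Finset.range p, q j • algebraMap (𝓞 L) L α ^ j) := by
    rw [← hq]
    exact z.isIntegral_coe
  have hqb : ∀ j ∈ Finset.range p, v.valuation K (q j) ≤ v.valuation K (b j) := by
    intro j hj
    refine hmin j (q j) ?_
    have h1 := (D.isIntegral_natCast_mul_smul_pow hzint (Finset.mem_range.1 hj)).pow p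
    rw [smul_pow, D.pow_pow_eq, Algebra.smul_def, ← map_mul, isIntegral_algebraMap_field_iff] at h1
    have h2 := valuation_le_one_of_isIntegral h1 v
    rwa [mul_pow, mul_assoc, map_mul, map_pow, hvp, one_pow, one_mul] at h2
  obtain ⟨t, ht, htint⟩ := exists_common_denominator v (Finset.range p)
    (x := fun j => q j / (algebraMap (𝓞 K) K s * b j * p)) (fun j hj => by
      rw [map_div₀, map_mul, map_mul, hvs, hvp, one_mul, mul_one]
      exact div_le_one_of_le₀ (hqb j hj) zero_le)
  let x : ℕ → K := fun j => algebraMap (𝓞 K) K t * (q j / (algebraMap (𝓞 K) K s * b j))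
  have hmem : D.spectral x ∈ associatedOrder (Subgroup.zpowers η) := by
    refine D.spectral_mem_associatedOrder fun j hj => ?_
    convert htint j (Finset.mem_range.2 hj) using 1
    have := hb j
    simp only [x]
    field_simp
  refine ⟨t, ht, ⟨_, hmem⟩, Subtype.ext ?_⟩
  change D.spectral x • algebraMap (𝓞 L) L y = algebraMap (𝓞 L) L (t • z)
  rw [hy, D.spectral_smul_sum, Algebra.smul_def, map_mul, hq,
    ← IsScalarTower.algebraMap_apply, IsScalarTower.algebraMap_apply (𝓞 K) K L,
    ← Algebra.smul_def, Finset.smul_sum]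
  refine Finset.sum_congr rfl fun j _ => ?_
  rw [smul_smul]
  congr 1
  have := hb j
  simp only [x]
  field_simp

/-- The element of `𝔄_𝔭` with eigenvalue `c j` on `α ^ j`, where `i` is the inverse of `p`. -/
def localSpectral (D : IsRadicalDatum p (algebraMap (𝓞 L) L α) (algebraMap (𝓞 K) K a) ζ σ η)
    {v : HeightOneSpectrum (𝓞 K)} (i : v.adicCompletionIntegers K)
    (c : ℕ → v.adicCompletionIntegers K) : LocalOrder (Subgroup.zpowers η) v :=
  ∑ j ∈ Finset.range p, (c j * i) ⊗ₜ[𝓞 K] D.scaledProj j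

theorem localSpectral_mul (D : IsRadicalDatum p (algebraMap (𝓞 L) L α) (algebraMap (𝓞 K) K a) ζ σ η)
    {v : HeightOneSpectrum (𝓞 K)} {i : v.adicCompletionIntegers K}
    (hi : i * p = 1) (c c' : ℕ → v.adicCompletionIntegers K) :
    D.localSpectral i c * D.localSpectral i c' = D.localSpectral i (c * c') := by
  simp only [localSpectral, Finset.sum_mul_sum, Algebra.TensorProduct.tmul_mul_tmul,
    D.scaledProj_mul]
  refine Finset.sum_congr rfl fun j hj => ?_
  rw [Finset.sum_eq_single j]
  · rw [if_pos rfl, ← mul_assoc, mul_tmul_nsmul hi, Pi.mul_apply, mul_right_comm]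
  · intro k _ hkj
    rw [if_neg hkj.symm, TensorProduct.tmul_zero]
  · exact fun h => absurd hj h

theorem localSpectral_one (D : IsRadicalDatum p (algebraMap (𝓞 L) L α) (algebraMap (𝓞 K) K a) ζ σ η)
    {v : HeightOneSpectrum (𝓞 K)} {i : v.adicCompletionIntegers K}
    (hi : i * p = 1) : D.localSpectral i 1 = 1 := by
  simp only [localSpectral, Pi.one_apply, ← TensorProduct.tmul_sum, D.sum_scaledProj]
  rw [mul_tmul_nsmul hi]
  rfl

theorem exists_generator_of_notMem
    (D : IsRadicalDatum p (algebraMap (𝓞 L) L α) (algebraMap (𝓞 K) K a) ζ σ η)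
    {v : HeightOneSpectrum (𝓞 K)} (hv : (p : 𝓞 K) ∉ v.asIdeal)
    {π : v.adicCompletion K} (hπ : Valued.v π = WithZero.exp (-1 : ℤ)) :
    ∃ y : LocalIntegers L v,
      toLocalField L v y =
        localGenerator p (algebraMap (𝓞 L) L α) (algebraMap (𝓞 K) K a) v π ∧
      IsFreeGenerator (LocalOrder (Subgroup.zpowers η) v) y := by
  obtain ⟨ϖ, hϖ⟩ := v.valuation_exists_uniformizer K
  have hϖ0 : ϖ ≠ 0 := by
    rintro rfl
    rw [map_zero] at hϖ
    exact WithZero.exp_ne_zero hϖ.symm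
  have hπ0 : π ≠ 0 := by
    rintro rfl
    rw [map_zero] at hπ
    exact WithZero.exp_ne_zero hπ.symm
  have hp0 := D.natCast_ne_zero
  have ha0 : ∀ j : ℕ, algebraMap (𝓞 K) K a ^ j ≠ 0 := fun j => pow_ne_zero j D.radicand_ne_zero
  let r : ℕ → ℤ := fun j => rFloor p v (algebraMap (𝓞 K) K a ^ j)
  let b : ℕ → K := fun j => (ϖ ^ r j)⁻¹
  have hb0 : ∀ j, b j ≠ 0 := fun j => inv_ne_zero (zpow_ne_zero _ hϖ0)
  obtain ⟨s, hs, hsint⟩ := D.exists_denominator_of_pow (v := v) (b := b) fun j =>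
    valuation_inv_zpow_pow_mul_le_one D.prime.pos v hϖ (ha0 j)
  have hvs : v.valuation K (algebraMap (𝓞 K) K s) = 1 := v.valuation_eq_one_iff_notMem.2 hs
  have hvp : v.valuation K (p : K) = 1 := by
    simpa using (v.valuation_eq_one_iff_notMem (K := K)).2 hv
  have hs0 : algebraMap (𝓞 K) K s ≠ 0 := by
    intro h
    rw [h, map_zero] at hvs
    exact zero_ne_one hvs
  have hexβ : ∀ j, ∃ x : 𝓞 L, j ∈ Finset.range p → algebraMap (𝓞 L) L x =
      (algebraMap (𝓞 K) K s * b j) • algebraMap (𝓞 L) L α ^ j := by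
    intro j
    by_cases hj : j ∈ Finset.range p
    · exact ⟨⟨_, hsint j hj⟩, fun _ => rfl⟩
    · exact ⟨0, fun h => absurd h hj⟩
  choose β hβ using hexβ
  have hsum : algebraMap (𝓞 L) L (∑ j ∈ Finset.range p, β j) =
      ∑ j ∈ Finset.range p, (algebraMap (𝓞 K) K s * b j) • algebraMap (𝓞 L) L α ^ j := by
    rw [map_sum]
    exact Finset.sum_congr rfl hβ
  have hgen := D.isFreeGenerator_of_notMem hv hs hb0
    (fun j q hq => valuation_le_inv_zpow D.prime.pos v hϖ (ha0 j) hq) hsum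
  -- the unit that corrects the scalars
  have hval : ∀ k : K, Valued.v (algebraMap K (v.adicCompletion K) k) = v.valuation K k :=
    fun k => v.valuedAdicCompletion_eq_valuation' k
  let γ : ℕ → v.adicCompletion K := fun j =>
    (algebraMap K (v.adicCompletion K) (p * (algebraMap (𝓞 K) K s * b j)))⁻¹ * (π ^ r j)⁻¹
  have hγ : ∀ j, Valued.v (γ j) = 1 := by
    intro j
    simp only [γ, b]
    rw [map_mul, map_inv₀, map_inv₀, map_zpow₀, hval, hπ, map_mul, map_mul, hvp, hvs, map_inv₀,
      map_zpow₀, hϖ, one_mul, one_mul, inv_inv,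
      mul_inv_cancel₀ (zpow_ne_zero _ WithZero.exp_ne_zero)]
  let c : ℕ → v.adicCompletionIntegers K := fun j => ⟨γ j, (hγ j).le⟩
  let c' : ℕ → v.adicCompletionIntegers K := fun j =>
    ⟨(γ j)⁻¹, by rw [HeightOneSpectrum.mem_adicCompletionIntegers, map_inv₀, hγ, inv_one]⟩
  have hcc' : c * c' = 1 := by
    funext j
    refine Subtype.ext (mul_inv_cancel₀ (a := γ j) ?_)
    rw [← Valuation.ne_zero_iff Valued.v, hγ]
    exact one_ne_zero
  obtain ⟨i, hi⟩ : ∃ i : v.adicCompletionIntegers K, i * p = 1 := by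
    have := isUnit_algebraMap_of_notMem hv
    rw [map_natCast] at this
    exact this.exists_left_inv
  have hU : IsUnit (D.localSpectral i c) :=
    ⟨⟨D.localSpectral i c, D.localSpectral i c',
      by rw [D.localSpectral_mul hi, hcc', D.localSpectral_one hi],
      by rw [D.localSpectral_mul hi, mul_comm, hcc', D.localSpectral_one hi]⟩, rfl⟩
  refine ⟨_, ?_, hgen.units_smul hU⟩
  have hU' : D.localSpectral i c • (1 ⊗ₜ[𝓞 K] ∑ j ∈ Finset.range p, β j : LocalIntegers L v) =
      ∑ j ∈ Finset.range p, c j ⊗ₜ[𝓞 K] β j := by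
    rw [localSpectral, Finset.sum_smul]
    refine Finset.sum_congr rfl fun j hj => ?_
    rw [tmul_smul_tmul, mul_one]
    have h1 : D.scaledProj j • ∑ j ∈ Finset.range p, β j = p • β j := by
      refine FaithfulSMul.algebraMap_injective (𝓞 L) L ?_
      have h2 : algebraMap (𝓞 L) L (D.scaledProj j • ∑ j ∈ Finset.range p, β j) =
        (D.scaledProj j).1 • algebraMap (𝓞 L) L (∑ j ∈ Finset.range p, β j) := rfl
      rw [h2, hsum, D.scaledProj_smul_sum _ (Finset.mem_range.1 hj), map_nsmul, hβ j hj,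
        ← Nat.cast_smul_eq_nsmul K, smul_smul]
    rw [h1, mul_tmul_nsmul hi]
  rw [hU', localGenerator, if_neg hv, map_sum, Finset.smul_sum]
  refine Finset.sum_congr rfl fun j hj => ?_
  rw [toLocalField_tmul, hβ j hj, ← TensorProduct.smul_tmul, TensorProduct.smul_tmul']
  congr 1
  have h3 : algebraMap K (v.adicCompletion K) (algebraMap (𝓞 K) K s * b j) ≠ 0 := by
    simpa using mul_ne_zero hs0 (hb0 j)
  have h4 : algebraMap K (v.adicCompletion K) (p : K) ≠ 0 := (map_ne_zero _).2 hp0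
  simp only [c, γ, r]
  rw [Algebra.smul_def, Algebra.smul_def, map_inv₀,
    map_mul (algebraMap K (v.adicCompletion K)) (p : K), mul_inv]
  field_simp

theorem exists_generator (D : IsRadicalDatum p (algebraMap (𝓞 L) L α) (algebraMap (𝓞 K) K a) ζ σ η)
    (ha : (p : 𝓞 K) ^ 2 ∣ a - 1) (v : HeightOneSpectrum (𝓞 K))
    {π : v.adicCompletion K} (hπ : Valued.v π = WithZero.exp (-1 : ℤ)) :
    ∃ y : LocalIntegers L v,
      toLocalField L v y =
        localGenerator p (algebraMap (𝓞 L) L α) (algebraMap (𝓞 K) K a) v π ∧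
      IsFreeGenerator (LocalOrder (Subgroup.zpowers η) v) y := by
  by_cases hv : (p : 𝓞 K) ∈ v.asIdeal
  · obtain ⟨y, hy⟩ : ∃ y : 𝓞 L, algebraMap (𝓞 L) L y =
        (p : L)⁻¹ * ∑ j ∈ Finset.range p, algebraMap (𝓞 L) L α ^ j :=
      ⟨⟨_, D.isIntegral_div_sum_pow ha⟩, rfl⟩
    refine ⟨_, ?_, D.isFreeGenerator_of_mem ha v hv hy⟩
    rw [toLocalField_tmul, localGenerator, if_pos hv, hy]
    rfl
  · exact D.exists_generator_of_notMem hv hπ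

end IsRadicalDatum

theorem IsFreeGenerator.nonempty_linearEquiv {A M : Type*} [Ring A] [AddCommGroup M] [Module A M]
    {y : M} (hy : IsFreeGenerator A y) : Nonempty (M ≃ₗ[A] A) :=
  ⟨(LinearEquiv.ofBijective (LinearMap.toSpanSingleton A M y) hy).symm⟩

end TameLocal

end HopfGalois

end

open HopfGalois IsDedekindDomain in
theorem mainTheorem2
    {K L E : Type*} [Field K] [Field L] [Field E] [NumberField K] [NumberField L] [NumberField E]
    [Algebra K L] [Algebra L E] [Algebra K E] [IsScalarTower K L E] [IsGalois K E]
    (p : ℕ) (hp : p.Prime)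
    (hunr : Algebra.IsUnramifiedIn (𝓞 K) (Ideal.span {(p : ℤ)}))
    -- `L = K(ω)` with `ω ^ p ∈ K`, not a `p`-th power in `K`
    (ω : L) (w : K) (hw : ω ^ p = algebraMap K L w) (hwK : ∀ b : K, b ^ p ≠ w)
    (hL : IntermediateField.adjoin K {ω} = ⊤)
    (htame : IsTame K L)
    -- `ζ ∉ K` is a primitive `p`-th root of unity and `E = K(ζ, ω)`
    (ζ : E) (hζ : IsPrimitiveRoot ζ p) (hζK : ζ ∉ (algebraMap K E).range)
    (hE : IntermediateField.adjoin K {ζ, algebraMap L E ω} = ⊤)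
    -- the automorphism `σ`, the permutation `η` of `G / G'`, and `N = ⟨η⟩`
    (σ : E ≃ₐ[K] E) (hσζ : σ ζ = ζ) (hσω : σ (algebraMap L E ω) = ζ * algebraMap L E ω)
    (η : Equiv.Perm (CosetSpace K L E))
    (hη : ∀ i : ℤ, η (QuotientGroup.mk (σ ^ i)) = QuotientGroup.mk (σ ^ (i - 1)))
    (N : Subgroup (Equiv.Perm (CosetSpace K L E))) (hN : N = Subgroup.zpowers η) :
    associatedOrder N = integralInvariants N ∧
    (∀ v : HeightOneSpectrum (𝓞 K),
      Nonempty (LocalIntegers L v ≃ₗ[LocalOrder N v] LocalOrder N v)) ∧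
    (∃ (α : 𝓞 L) (a : 𝓞 K), IntermediateField.adjoin K {(α : L)} = ⊤ ∧
      α ^ p = algebraMap (𝓞 K) (𝓞 L) a ∧ (p : 𝓞 K) ^ 2 ∣ a - 1) ∧
    ∀ (α : 𝓞 L) (a : 𝓞 K), IntermediateField.adjoin K {(α : L)} = ⊤ →
      α ^ p = algebraMap (𝓞 K) (𝓞 L) a → (p : 𝓞 K) ^ 2 ∣ a - 1 →
      ∀ (v : HeightOneSpectrum (𝓞 K)) (π : v.adicCompletion K),
        Valued.v π = WithZero.exp (-1 : ℤ) →
        ∃ y : LocalIntegers L v,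
          toLocalField L v y = localGenerator p (α : L) (a : K) v π ∧
          IsFreeGenerator (LocalOrder N v) y := by
  subst hN
  have hw0 : w ≠ 0 := fun h => hwK 0 (by rw [h, zero_pow hp.ne_zero])
  have hω0 : ω ≠ 0 := by
    rintro rfl
    rw [zero_pow hp.ne_zero, eq_comm, map_eq_zero] at hw
    exact hw0 hw
  have D : IsRadicalDatum p ω w ζ σ η := ⟨hp, hζ, hω0, hw, hL, hσζ, hσω, hη⟩
  have hex := exists_radical_generator htame hp hunr hw0 hw hL
  have hdatum : ∀ (α : 𝓞 L) (a : 𝓞 K),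
      IntermediateField.adjoin K {algebraMap (𝓞 L) L α} = ⊤ →
      α ^ p = algebraMap (𝓞 K) (𝓞 L) a →
      ∃ ζ' : E, IsRadicalDatum p (algebraMap (𝓞 L) L α) (algebraMap (𝓞 K) K a) ζ' σ η := by
    intro α a hα hαa
    refine D.of_adjoin_eq_top hα ?_
    rw [← map_pow, hαa, ← IsScalarTower.algebraMap_apply, ← IsScalarTower.algebraMap_apply]
  obtain ⟨α, a, hα, hαa, ha⟩ := hex
  obtain ⟨ζ', D'⟩ := hdatum α a hα hαa
  refine ⟨D'.associatedOrder_eq ha, fun v => ?_, ⟨α, a, hα, hαa, ha⟩, ?_⟩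
  · obtain ⟨ϖ, hϖ⟩ := v.valuation_exists_uniformizer K
    obtain ⟨y, -, hy⟩ := D'.exists_generator ha v (π := algebraMap K (v.adicCompletion K) ϖ)
      ((v.valuedAdicCompletion_eq_valuation' ϖ).trans hϖ)
    exact hy.nonempty_linearEquiv
  · intro α a hα hαa ha v π hπ
    obtain ⟨ζ', D'⟩ := hdatum α a hα hαa
    exact D'.exists_generator ha v hπ
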